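/- Let $m\ge 1$, let $a_1,\dots,a_m,b_1,\dots,b_m$ be positive real numbers, $Q_i(z,w)=1-a_iz-b_iw$ and $Q=\prod_{i=1}^m Q_i$. Assume that the complex lines $\mathcal V_i=\{Q_i=0\}$ are in general position: any two of them meet in exactly one point, i.e. $\Delta_{ij}=a_ib_j-a_jb_i\ne 0$ for $i\neq j$, and no three of them have a common point. Let $M\subset\mathbb R^2$ be the closure of the polygon $\{z>0,\ w>0,\ Q_i(z,w)>0,\ i=1,\dots,m\}$. For $(p,q)\in\mathbb R_+^2\setminus\{0\}$, where $\mathbb R_+=[0,\infty)$, let $$(z_i,w_i)=\Bigl(\tfrac{p}{a_i(p+q)},\tfrac{q}{b_i(p+q)}\Bigr)$$ be the solution of $Q_i=0$, $qz\,\partial_zQ_i=pw\,\partial_wQ_i$, and for $i\ne j$ let $(z_{ij},w_{ij})$ be the solution of $Q_i=Q_j=0$. Let $K_i$ be the set of $(p,q)\in\mathbb R_+^2\setminus\{0\}$ for which the maximum of $z^pw^q$ over $M$ and its maximum over $\mathcal V_i\cap\mathbb R_+^2$ are both attained at $(z_i,w_i)$ (in particular $(z_i,w_i)\in M$), and let $\Omega_{ij}$,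 $i\neq j$, be the set of $(p,q)\in\mathbb R_+^2$ for which the maximum of $z^pw^q$ over $M$ is attained at $(z_{ij},w_{ij})\in M$. Interiors are taken in $\mathbb R^2$. Then there are nonzero real constants $c_i(p,q)$ ($1\le i\le m$, $p,q\in\mathbb Z_+$) and $c_{ij}$ ($i\ne j$), depending on $Q$ but not on $P$ or $k$ (and $c_{ij}$ not on $p,q$), with the following property. Let $P\in\mathbb C[z,w]$ have no common nonconstant factor with $Q$, let $P\neq 0$ at every vertex of $M$ that does not lie on a coordinate axis, and let $f(x,y)$ be the Taylor coefficients at the origin of $$F(z,w)=\frac{P(z,w)}{Q(z,w)}=\sum_{x,y\ge 0}f(x,y)z^xw^y .$$ Then for almost all $(p,q)\in\mathbb Z_+^2$, namely for all $(p,q)\in\mathbb Z_+^2$ outside the union of finitely many lines through the origin (which may depend on $P$ and $Q$), the point $(p,q)$ lies in the interior of some $K_i$ or of some $\Omega_{ij}$, and, as $k\to\infty$, $$f(kp,kq)\sim\frac{c_i(p,q)}{\sqrt k}\cdot\frac{P(z_i,w_i)}{z_i^{\,kp+1}w_i^{\,kq+1}}\qquad\text{if }(p,q)\in\operatorname{Int}K_i,$$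 $$f(kp,kq)\sim c_{ij}\cdot\frac{P(z_{ij},w_{ij})}{z_{ij}^{\,kp+1}w_{ij}^{\,kq+1}}\qquad\text{if }(p,q)\in\operatorname{Int}\Omega_{ij}.$$ -/

import Mathlib

open Filter Topology Asymptotics

noncomputable section

namespace LinearPoles

variable {m : ℕ}

/-- The linear polynomial `Q_i = 1 - a_i z - b_i w` (`X 0` is `z` and `X 1` is `w`). -/
def linFactor (a b : Fin m → ℝ) (i : Fin m) : MvPolynomial (Fin 2) ℂ :=
  1 - MvPolynomial.C (a i : ℂ) * MvPolynomial.X 0 - MvPolynomial.C (b i : ℂ) * MvPolynomial.X 1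

/-- The denominator `Q = ∏ Q_i`. -/
def denom (a b : Fin m → ℝ) : MvPolynomial (Fin 2) ℂ := ∏ i, linFactor a b i

/-- The value `P(z, w)` of a polynomial in two variables. -/
def evalAt (P : MvPolynomial (Fin 2) ℂ) (z w : ℂ) : ℂ := MvPolynomial.eval ![z, w] P

/-- The value of a polynomial at a point of the real plane. -/
def evalAtReal (P : MvPolynomial (Fin 2) ℂ) (v : ℝ × ℝ) : ℂ := evalAt P (v.1 : ℂ) (v.2 : ℂ)

/-- `f x y` are the Taylor coefficients at the origin of the rational function `P / Q`:
near the origin `P(z,w) / Q(z,w) = ∑ f(x,y) z^x w^y`. -/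
def IsTaylorCoeff (P Q : MvPolynomial (Fin 2) ℂ) (f : ℕ → ℕ → ℂ) : Prop :=
  ∀ᶠ v : ℂ × ℂ in 𝓝 0,
    HasSum (fun n : ℕ × ℕ => f n.1 n.2 * v.1 ^ n.1 * v.2 ^ n.2)
      (evalAt P v.1 v.2 / evalAt Q v.1 v.2)

/-- The determinant `Δ_ij` of the linear system `Q_i = Q_j = 0`. -/
def delta (a b : Fin m → ℝ) (i j : Fin m) : ℝ := a i * b j - a j * b i

/-- The complex lines `{Q_i = 0}` are in general position: any two of them meet in exactly one
point (the determinant of the system does not vanish), and no three have a common point. -/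
structure GeneralPosition (a b : Fin m → ℝ) : Prop where
  pair : ∀ i j, i ≠ j → delta a b i j ≠ 0
  triple : ∀ i j k, i ≠ j → j ≠ k → i ≠ k →
    ¬ ∃ z w : ℂ, evalAt (linFactor a b i) z w = 0 ∧ evalAt (linFactor a b j) z w = 0 ∧
      evalAt (linFactor a b k) z w = 0

/-- The polygon `z > 0, w > 0, Q_i(z,w) > 0`. Maxima over it, and its vertices, are those of
its closure. -/
def openPolygon (a b : Fin m → ℝ) : Set (ℝ × ℝ) :=
  {v | 0 < v.1 ∧ 0 < v.2 ∧ ∀ i, 0 < 1 - a i * v.1 - b i * v.2}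

/-- The closed polygon `M`. -/
def polygon (a b : Fin m → ℝ) : Set (ℝ × ℝ) := closure (openPolygon a b)

theorem mem_polygon_iff {a b : Fin m → ℝ} (v : ℝ × ℝ) :
    v ∈ polygon a b ↔ 0 ≤ v.1 ∧ 0 ≤ v.2 ∧ ∀ i, 0 ≤ 1 - a i * v.1 - b i * v.2 := by
  constructor
  · intro hv
    have hc : IsClosed {v : ℝ × ℝ | 0 ≤ v.1 ∧ 0 ≤ v.2 ∧ ∀ i, 0 ≤ 1 - a i * v.1 - b i * v.2} := by
      simp only [Set.ofPred_and, Set.ofPred_forall]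
      refine (isClosed_le (by fun_prop) (by fun_prop)).inter
        ((isClosed_le (by fun_prop) (by fun_prop)).inter
          (isClosed_iInter fun i => isClosed_le (by fun_prop) (by fun_prop)))
    refine closure_minimal ?_ hc hv
    rintro u ⟨u1, u2, u3⟩
    exact ⟨u1.le, u2.le, fun i => (u3 i).le⟩
  · rintro ⟨h1, h2, h3⟩
    have hev : ∀ᶠ s : ℝ in 𝓝[>] 0, 0 < s ∧ ∀ i, 0 < 1 - a i * s - b i * s := by
      refine (eventually_mem_nhdsWithin).and ((eventually_all).2 fun i => ?_)
      have hcont : Continuous fun s : ℝ => 1 - a i * s - b i * s := by fun_prop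
      have := hcont.tendsto 0
      simp only [mul_zero, sub_zero] at this
      exact (this.eventually (lt_mem_nhds one_pos)).filter_mono nhdsWithin_le_nhds
    obtain ⟨s, hs, hsi⟩ := hev.exists
    have hlim : Tendsto (fun t : ℝ => ((1 - t) * v.1 + t * s, (1 - t) * v.2 + t * s))
        (𝓝[>] 0) (𝓝 v) := by
      have hcont : Continuous fun t : ℝ => ((1 - t) * v.1 + t * s, (1 - t) * v.2 + t * s) := by
        fun_prop
      have := hcont.tendsto 0
      simp only [sub_zero, one_mul, zero_mul, add_zero] at this
      exact this.mono_left nhdsWithin_le_nhds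
    refine mem_closure_of_tendsto hlim ?_
    filter_upwards [Ioo_mem_nhdsGT (zero_lt_one' ℝ)] with t ht
    have h1t : 0 < 1 - t := sub_pos.2 ht.2
    have hts := mul_pos ht.1 hs
    refine ⟨add_pos_of_nonneg_of_pos (mul_nonneg h1t.le h1) hts,
      add_pos_of_nonneg_of_pos (mul_nonneg h1t.le h2) hts, fun i => ?_⟩
    have e1 := mul_nonneg h1t.le (h3 i)
    have e2 := mul_pos ht.1 (hsi i)
    dsimp only
    nlinarith

/-- The part of the line `Q_i = 0` in the closed positive quadrant. -/
def lineInQuadrant (a b : Fin m → ℝ) (i : Fin m) : Set (ℝ × ℝ) :=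
  {v | 0 ≤ v.1 ∧ 0 ≤ v.2 ∧ 1 - a i * v.1 - b i * v.2 = 0}

/-- The function `(z, w) ↦ z ^ p * w ^ q` for a real direction `d = (p, q)`. -/
def mono (d v : ℝ × ℝ) : ℝ := v.1 ^ d.1 * v.2 ^ d.2

/-- The function `g` has a maximum over `S`, and it is attained at the point `v` of `S`. -/
def MaxAttainedAt (g : ℝ × ℝ → ℝ) (S : Set (ℝ × ℝ)) (v : ℝ × ℝ) : Prop :=
  v ∈ S ∧ IsMaxOn g S v

/-- The critical point `(z_i, w_i)` of `z ^ p * w ^ q` on the line `Q_i = 0`,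
for `d = (p, q)`. -/
def critPt (a b : Fin m → ℝ) (i : Fin m) (d : ℝ × ℝ) : ℝ × ℝ :=
  (d.1 / (a i * (d.1 + d.2)), d.2 / (b i * (d.1 + d.2)))

/-- `(z_i, w_i)` is the solution of `Q_i = 0`, `q z ∂Q_i/∂z - p w ∂Q_i/∂w = 0`. -/
theorem eq_critPt_iff {a b : Fin m → ℝ} {i : Fin m} {d : ℝ × ℝ} (ha : 0 < a i) (hb : 0 < b i)
    (hd : 0 < d.1 + d.2) (v : ℝ × ℝ) :
    v = critPt a b i d ↔ 1 - a i * v.1 - b i * v.2 = 0 ∧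
      d.2 * v.1 * (-a i) - d.1 * v.2 * (-b i) = 0 := by
  have ha' := ha.ne'
  have hb' := hb.ne'
  have hd' := hd.ne'
  constructor
  · rintro rfl
    simp only [critPt]
    constructor
    · field_simp
      ring
    · field_simp
      ring
  · rintro ⟨h1, h2⟩
    refine Prod.ext ?_ ?_
    · simp only [critPt]
      rw [eq_div_iff (by positivity)]
      linear_combination (-d.1) * h1 - h2
    · simp only [critPt]
      rw [eq_div_iff (by positivity)]
      linear_combination (-d.2) * h1 + h2

/-- The common point `(z_ij, w_ij)` of the lines `Q_i = 0` and `Q_j = 0` (for `Δ_ij ≠ 0`). -/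
def interPt (a b : Fin m → ℝ) (i j : Fin m) : ℝ × ℝ :=
  ((b j - b i) / delta a b i j, (a i - a j) / delta a b i j)

/-- `(z_ij, w_ij)` is the solution of `Q_i = Q_j = 0`. -/
theorem eq_interPt_iff {a b : Fin m → ℝ} {i j : Fin m} (h : delta a b i j ≠ 0) (v : ℝ × ℝ) :
    v = interPt a b i j ↔
      1 - a i * v.1 - b i * v.2 = 0 ∧ 1 - a j * v.1 - b j * v.2 = 0 := by
  constructor
  · rintro rfl
    simp only [interPt]
    constructor
    · field_simp
      simp only [delta]
      ring
    · field_simp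
      simp only [delta]
      ring
  · rintro ⟨h1, h2⟩
    refine Prod.ext ?_ ?_
    · simp only [interPt]
      rw [eq_div_iff h, delta]
      linear_combination (-b j) * h1 + b i * h2
    · simp only [interPt]
      rw [eq_div_iff h, delta]
      linear_combination a j * h1 - a i * h2

/-- The cone `K_i` of the directions `(p, q)` in the positive quadrant for which the maxima of
`z ^ p * w ^ q` over `M` and over the line `Q_i = 0` are both attained at `(z_i, w_i)`. -/
def coneK (a b : Fin m → ℝ) (i : Fin m) : Set (ℝ × ℝ) :=
  {d | 0 ≤ d.1 ∧ 0 ≤ d.2 ∧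
    MaxAttainedAt (mono d) (polygon a b) (critPt a b i d) ∧
    MaxAttainedAt (mono d) (lineInQuadrant a b i) (critPt a b i d)}

/-- The cone `Ω_ij` of the directions `(p, q)` in the positive quadrant for which the maximum of
`z ^ p * w ^ q` over `M` is attained at `(z_ij, w_ij)`. -/
def coneOmega (a b : Fin m → ℝ) (i j : Fin m) : Set (ℝ × ℝ) :=
  {d | 0 ≤ d.1 ∧ 0 ≤ d.2 ∧ MaxAttainedAt (mono d) (polygon a b) (interPt a b i j)}

/-- A property holds for almost all `(p, q)` in `ℤ²₊`: for all that lie outside the union of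
finitely many lines through the origin. -/
def ForAlmostAllDirections (S : ℕ → ℕ → Prop) : Prop :=
  ∃ E : Finset (ℝ × ℝ), ∀ p q : ℕ,
    (∀ e ∈ E, ∀ t : ℝ, ((p : ℝ), (q : ℝ)) ≠ t • e) → S p q

/-- The diagonal asymptotics `f(kp, kq) ~ C(k) P(ẑ, ŵ) / (ẑ^(kp+1) ŵ^(kq+1))` as `k → ∞`, with
`(ẑ, ŵ) = v`. -/
def DiagonalAsymptotics (f : ℕ → ℕ → ℂ) (P : MvPolynomial (Fin 2) ℂ) (p q : ℕ)
    (C : ℕ → ℝ) (v : ℝ × ℝ) : Prop :=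
  (fun k : ℕ => f (k * p) (k * q)) ~[atTop]
    fun k : ℕ => (C k : ℂ) * (evalAtReal P v / ((v.1 : ℂ) ^ (k * p + 1) * (v.2 : ℂ) ^ (k * q + 1)))

end LinearPoles

end

/-! For T = {i} or T = {i, j}, write F = G · ∏_{l ∈ T} 1/Q_l with G = P/∏_{l ∉ T} Q_l. At the
relevant point v (the critical point or the vertex) Q_l(v) > 0 for l ∉ T; since the a_l, b_l are
positive, the series of G converges absolutely even at (1 + ε)v. Multiplying f(kp, kq) by the
monomial at v turns it into a sum over (s, t) of the terms of G at v against the rescaled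
coefficients H(kp - s, kq - t) of ∏_{l ∈ T} 1/Q_l. If N_k H(kp - s, kq - t) has a limit L
independent of (s, t) and is O(s + t + 1) uniformly in k, Tannery's theorem gives the limit L · G(v)
(`tendsto_conv`, `tendsto_of_isTaylorCoeff`).

Because Q_l(v) = 0 for l ∈ T, the rescaled weights a_l z, b_l w sum to 1 and H is probabilistic. For
T = {i} it is a binomial probability at its mode, up to the shift, and Stirling's formula applies
with N_k = √k (`tendsto_sqrt_mul_geom`). For T = {i, j} partial fractions make H a multiple of the
difference of two negative binomial distribution functions (`sub_mul_conv_geom`). By a Chernoff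
bound one tends to 1 and the other to 0 when the slopes of the monomial along the two lines have
opposite signs (`tendsto_conv_geom`).

The geometry says when this applies. A maximum over M forces slopes of both signs, or a zero slope,
among the active lines (`not_isMaxOn_of_slope_pos`); conversely weighted AM-GM shows such points to
be maxima, stably in the direction (`mem_interior_coneK`, `mem_interior_coneOmega`). The degenerate
directions are the axes, those with a zero slope at an intersection point, and those whose critical
point is a zero of P; the last are finite in number because P has finitely many real zeros on each
line (`finite_zeros_on_line`). -/

noncomputable section

namespace LinearPoles

/-! ### Double power series: Cauchy products, uniqueness of coefficients, Tannery's theorem. -/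

section GeneratingFunctions

variable {𝕜 : Type*} [RCLike 𝕜]

/-- The monomial `z ^ x * w ^ y`. -/
def monom (v : 𝕜 × 𝕜) (n : ℕ × ℕ) : 𝕜 := v.1 ^ n.1 * v.2 ^ n.2

theorem monom_add (v : 𝕜 × 𝕜) (k l : ℕ × ℕ) : monom v (k + l) = monom v k * monom v l := by
  simp only [monom, Prod.fst_add, Prod.snd_add, pow_add]
  ring

/-- The double power series with coefficients `f` converges (absolutely) at `v` to `s`. -/
def GenSum (f : ℕ × ℕ → 𝕜) (v : 𝕜 × 𝕜) (s : 𝕜) : Prop :=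
  HasSum (fun n => f n * monom v n) s

/-- Makes the general Cauchy product theorem available for double sequences: the pairs with sum n
are (k, n - k) with k ≤ n componentwise, where truncated subtraction is harmless. -/
instance : Finset.HasAntidiagonal (ℕ × ℕ) where
  antidiagonal n := (Finset.Iic n).map ⟨fun k => (k, n - k), fun _ _ h => congrArg Prod.fst h⟩
  mem_antidiagonal {n a} := by
    simp only [Finset.mem_map, Finset.mem_Iic]
    constructor
    · rintro ⟨k, hk, rfl⟩
      exact add_tsub_cancel_of_le hk
    · rintro rfl
      exact ⟨a.1, le_self_add, Prod.ext rfl (add_tsub_cancel_left a.1 a.2)⟩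

/-- The Cauchy product of double sequences. -/
def conv (f g : ℕ × ℕ → 𝕜) (n : ℕ × ℕ) : 𝕜 := ∑ k ∈ Finset.Iic n, f k * g (n - k)

theorem conv_eq_sum_antidiagonal (f g : ℕ × ℕ → 𝕜) (n : ℕ × ℕ) :
    conv f g n = ∑ kl ∈ Finset.HasAntidiagonal.antidiagonal n, f kl.1 * g kl.2 :=
  (Finset.sum_map (Finset.Iic n) ⟨fun k => (k, n - k), fun _ _ h => congrArg Prod.fst h⟩
    fun kl : (ℕ × ℕ) × (ℕ × ℕ) => f kl.1 * g kl.2).symm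

theorem conv_mul_monom (f g : ℕ × ℕ → 𝕜) (v : 𝕜 × 𝕜) (n : ℕ × ℕ) :
    conv f g n * monom v n = conv (fun k => f k * monom v k) (fun k => g k * monom v k) n := by
  rw [conv_eq_sum_antidiagonal, conv_eq_sum_antidiagonal, Finset.sum_mul]
  refine Finset.sum_congr rfl fun kl hkl => ?_
  rw [← Finset.HasAntidiagonal.mem_antidiagonal.1 hkl, monom_add]
  ring

theorem hasSum_conv {f g : ℕ × ℕ → 𝕜} {s t : 𝕜} (hf : HasSum f s) (hg : HasSum g t) :
    HasSum (conv f g) (s * t) := by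
  have hfg : Summable fun x : (ℕ × ℕ) × (ℕ × ℕ) => f x.1 * g x.2 :=
    summable_mul_of_summable_norm hf.summable.norm hg.summable.norm
  have hs := summable_sum_mul_antidiagonal_of_summable_mul hfg
  have h2 := hf.summable.tsum_mul_tsum_eq_tsum_sum_antidiagonal hg.summable hfg
  rw [hf.tsum_eq, hg.tsum_eq] at h2
  simp only [← conv_eq_sum_antidiagonal] at hs h2
  exact h2 ▸ hs.hasSum

theorem GenSum.mul_conv {f g : ℕ × ℕ → 𝕜} {v : 𝕜 × 𝕜} {s t : 𝕜} (hf : GenSum f v s)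
    (hg : GenSum g v t) : GenSum (conv f g) v (s * t) := by
  simp only [GenSum, conv_mul_monom]
  exact hasSum_conv hf hg

theorem GenSum.add {f g : ℕ × ℕ → 𝕜} {v : 𝕜 × 𝕜} {s t : 𝕜} (hf : GenSum f v s)
    (hg : GenSum g v t) : GenSum (fun n => f n + g n) v (s + t) := by
  simpa only [GenSum, add_mul] using HasSum.add hf hg

theorem GenSum.sub {f g : ℕ × ℕ → 𝕜} {v : 𝕜 × 𝕜} {s t : 𝕜} (hf : GenSum f v s)
    (hg : GenSum g v t) : GenSum (fun n => f n - g n) v (s - t) := by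
  simpa only [GenSum, sub_mul] using HasSum.sub hf hg

theorem GenSum.const_mul {f : ℕ × ℕ → 𝕜} {v : 𝕜 × 𝕜} {s : 𝕜} (c : 𝕜) (hf : GenSum f v s) :
    GenSum (fun n => c * f n) v (c * s) := by
  simpa only [GenSum, mul_assoc] using HasSum.mul_left c hf

/-- A power series in one variable that vanishes near the origin has zero coefficients. -/
theorem coeff_eq_zero_of_eventually_hasSum {c : ℕ → 𝕜}
    (h : ∀ᶠ z : 𝕜 in 𝓝 0, HasSum (fun n => c n * z ^ n) 0) : c = 0 := by
  have hp : HasFPowerSeriesAt (fun _ : 𝕜 => (0 : 𝕜)) (FormalMultilinearSeries.ofScalars 𝕜 c) 0 := by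
    rw [hasFPowerSeriesAt_iff]
    filter_upwards [h] with z hz
    simpa [FormalMultilinearSeries.coeff_ofScalars, mul_comm] using hz
  have h0 := hp.eq_zero
  funext n
  have := congrArg (fun s : FormalMultilinearSeries 𝕜 𝕜 𝕜 => s.coeff n) h0
  rwa [FormalMultilinearSeries.coeff_ofScalars] at this

/-- A double power series that vanishes near the origin has zero coefficients. -/
theorem eq_zero_of_eventually_genSum {d : ℕ × ℕ → 𝕜}
    (h : ∀ᶠ v : 𝕜 × 𝕜 in 𝓝 0, GenSum d v 0) : d = 0 := by
  -- The swap lets currying fix w first and leave a neighbourhood of z, so that one-variable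
  -- uniqueness applies in z and then in w.
  have hswap : ∀ᶠ v : 𝕜 × 𝕜 in 𝓝 ((0 : 𝕜), (0 : 𝕜)), GenSum d (v.2, v.1) 0 := by
    have hc : Tendsto (fun v : 𝕜 × 𝕜 => (v.2, v.1)) (𝓝 (0, 0)) (𝓝 (0, 0)) :=
      (continuous_snd.prodMk continuous_fst).tendsto (0, 0)
    exact hc.eventually h
  have hw : ∀ᶠ w : 𝕜 in 𝓝 0, ∀ x, HasSum (fun y => d (x, y) * w ^ y) 0 := by
    filter_upwards [hswap.curry_nhds] with w hw
    -- A nonzero z₀ allows division by z₀ ^ x, which makes each row summable by itself.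
    obtain ⟨z₀, hz₀, hz₀0⟩ : ∃ z₀ : 𝕜, GenSum d (z₀, w) 0 ∧ z₀ ≠ 0 := by
      have h1 : ∀ᶠ z : 𝕜 in 𝓝[≠] 0, GenSum d (z, w) 0 := hw.filter_mono nhdsWithin_le_nhds
      exact (h1.and eventually_mem_nhdsWithin).exists
    have hsum : ∀ x, Summable fun y => d (x, y) * w ^ y := by
      intro x
      have := (hz₀.summable.prod_factor x).mul_right (z₀ ^ x)⁻¹
      refine this.congr fun y => ?_
      simp only [monom]
      field_simp
    have hzero : (fun x => ∑' y, d (x, y) * w ^ y) = 0 := by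
      refine coeff_eq_zero_of_eventually_hasSum ?_
      filter_upwards [hw] with z hz
      refine HasSum.prod_fiberwise hz fun x => ?_
      convert! (hsum x).hasSum.mul_right (z ^ x) using 2
      simp only [monom]
      ring
    intro x
    have h0 : ∑' y, d (x, y) * w ^ y = 0 := congrFun hzero x
    exact h0 ▸ (hsum x).hasSum
  funext ⟨x, y⟩
  exact congrFun (coeff_eq_zero_of_eventually_hasSum (c := fun y => d (x, y))
    (hw.mono fun w hw => hw x)) y

/-- The coefficients of a double power series are determined by its sum near the origin. -/
theorem eq_of_eventually_genSum {f g : ℕ × ℕ → 𝕜} {φ : 𝕜 × 𝕜 → 𝕜}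
    (hf : ∀ᶠ v : 𝕜 × 𝕜 in 𝓝 0, GenSum f v (φ v)) (hg : ∀ᶠ v : 𝕜 × 𝕜 in 𝓝 0, GenSum g v (φ v)) :
    f = g := by
  have : (fun n => f n - g n) = 0 := by
    refine eq_zero_of_eventually_genSum ?_
    filter_upwards [hf, hg] with v h1 h2
    simpa using h1.sub h2
  funext n
  exact sub_eq_zero.1 (congrFun this n)

/-- The Taylor coefficients of `1 / (1 - a z - b w)`. -/
def geom (a b : 𝕜) (n : ℕ × ℕ) : 𝕜 := ((n.1 + n.2).choose n.1 : 𝕜) * a ^ n.1 * b ^ n.2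

theorem geom_mul_monom (a b : 𝕜) (v : 𝕜 × 𝕜) (n : ℕ × ℕ) :
    geom a b n * monom v n = geom (a * v.1) (b * v.2) n := by
  simp only [geom, monom, mul_pow]
  ring

theorem sum_antidiagonal_geom (a b : 𝕜) (n : ℕ) :
    ∑ k ∈ Finset.HasAntidiagonal.antidiagonal n, geom a b k = (a + b) ^ n := by
  rw [(Commute.all a b).add_pow']
  refine Finset.sum_congr rfl fun k hk => ?_
  rw [geom, Finset.HasAntidiagonal.mem_antidiagonal.1 hk, nsmul_eq_mul, mul_assoc]

/-- Grouping by total degree, the binomial theorem reduces the double series to the geometric series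
in a + b, and its norms to that in ‖a‖ + ‖b‖. -/
theorem hasSum_geom {a b : 𝕜} (h : ‖a‖ + ‖b‖ < 1) : HasSum (geom a b) (1 - a - b)⁻¹ := by
  have hnorm : ∀ k, ‖geom a b k‖ = geom ‖a‖ ‖b‖ k := fun k => by
    simp [geom]
  have hsn : Summable fun k => ‖geom a b k‖ := by
    rw [← Finset.HasAntidiagonal.sigmaAntidiagonalEquivProd.summable_iff]
    refine (summable_sigma_of_nonneg fun _ => norm_nonneg _).2 ⟨fun n => (hasSum_fintype _).summable, ?_⟩
    have : ∀ n : ℕ, ∑' k : Finset.HasAntidiagonal.antidiagonal n, ‖geom a b k‖ = (‖a‖ + ‖b‖) ^ n := fun n => by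
      rw [tsum_fintype, Finset.sum_coe_sort _ fun k : ℕ × ℕ => ‖geom a b k‖]
      simp only [hnorm]
      exact sum_antidiagonal_geom _ _ _
    exact (summable_geometric_of_lt_one (by positivity) h).congr fun n => (this n).symm
  rw [← Finset.HasAntidiagonal.sigmaAntidiagonalEquivProd.hasSum_iff]
  have hlt : ‖a + b‖ < 1 := (norm_add_le a b).trans_lt h
  have hg := hasSum_geometric_of_norm_lt_one hlt
  rw [← sub_sub] at hg
  refine HasSum.sigma_of_hasSum hg (fun n => ?_)
    (Finset.HasAntidiagonal.sigmaAntidiagonalEquivProd.summable_iff.2 hsn.of_norm)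
  rw [← sum_antidiagonal_geom, ← Finset.sum_coe_sort]
  exact hasSum_fintype _

theorem genSum_geom {a b : 𝕜} {v : 𝕜 × 𝕜} (h : ‖a * v.1‖ + ‖b * v.2‖ < 1) :
    GenSum (geom a b) v (1 - a * v.1 - b * v.2)⁻¹ := by
  simpa only [GenSum, geom_mul_monom] using hasSum_geom h

theorem eventually_norm_add_norm_lt_one (a b : 𝕜) :
    ∀ᶠ v : 𝕜 × 𝕜 in 𝓝 0, ‖a * v.1‖ + ‖b * v.2‖ < 1 := by
  have hc : Continuous fun v : 𝕜 × 𝕜 => ‖a * v.1‖ + ‖b * v.2‖ := by fun_prop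
  exact (hc.tendsto 0).eventually (gt_mem_nhds (by simp))

/-- Tannery's theorem for Cauchy products along a ray. -/
theorem tendsto_conv {g h : ℕ × ℕ → 𝕜} {N : ℕ → 𝕜} {L S : 𝕜} {B : ℕ × ℕ → ℝ} {p q : ℕ}
    (hg : HasSum g S) (hB : Summable fun n => ‖g n‖ * B n) (hB0 : ∀ n, 0 ≤ B n)
    (hlim : ∀ s t : ℕ, Tendsto (fun k => N k * h (k * p - s, k * q - t)) atTop (𝓝 L))
    (hbound : ∀ k s t : ℕ, s ≤ k * p → t ≤ k * q →
      ‖N k * h (k * p - s, k * q - t)‖ ≤ B (s, t)) (hp : 0 < p) (hq : 0 < q) :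
    Tendsto (fun k => N k * conv g h (k * p, k * q)) atTop (𝓝 (L * S)) := by
  -- Extending the finite sum by zero gives an index set independent of k, as dominated convergence
  -- requires.
  have hrw : ∀ k, N k * conv g h (k * p, k * q) = ∑' n : ℕ × ℕ,
      if n ≤ (k * p, k * q) then g n * (N k * h ((k * p, k * q) - n)) else 0 := by
    intro k
    rw [tsum_eq_sum (s := Finset.Iic (k * p, k * q))
      (fun n hn => if_neg fun h => hn (Finset.mem_Iic.2 h)), conv, Finset.mul_sum]
    refine Finset.sum_congr rfl fun n hn => ?_
    rw [if_pos (Finset.mem_Iic.1 hn)]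
    ring
  simp only [hrw]
  rw [mul_comm L, ← hg.tsum_eq, ← tsum_mul_right]
  refine tendsto_tsum_of_dominated_convergence hB (fun n => ?_)
    (Eventually.of_forall fun k n => ?_)
  · refine Tendsto.congr' ?_ ((hlim n.1 n.2).const_mul (g n))
    filter_upwards [eventually_ge_atTop (n.1 + n.2)] with k hk
    have h1 : n.1 ≤ k * p := by nlinarith
    have h2 : n.2 ≤ k * q := by nlinarith
    rw [if_pos (Prod.le_def.2 ⟨h1, h2⟩)]
    rfl
  · split_ifs with hn
    · rw [norm_mul]
      exact mul_le_mul_of_nonneg_left (hbound k n.1 n.2 hn.1 hn.2) (norm_nonneg _)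
    · rw [norm_zero]
      exact mul_nonneg (norm_nonneg _) (hB0 n)

end GeneratingFunctions

/-! ### Local limit theorem for binomial probabilities along a ray, with a uniform bound. -/

section LocalLimit

theorem geom_nonneg {a b : ℝ} (ha : 0 ≤ a) (hb : 0 ≤ b) (n : ℕ × ℕ) : 0 ≤ geom a b n := by
  unfold geom
  positivity

theorem geom_swap (a b : ℝ) (x y : ℕ) : geom a b (x, y) = geom b a (y, x) := by
  simp only [geom]
  rw [add_comm y x, Nat.choose_symm_add]
  ring

theorem geom_succ_succ (a b : ℝ) (x y : ℕ) :
    geom a b (x + 1, y + 1) = a * geom a b (x, y + 1) + b * geom a b (x + 1, y) := by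
  simp only [geom]
  rw [show x + 1 + (y + 1) = (x + y + 1) + 1 by ring, Nat.choose_succ_succ,
    show x + (y + 1) = x + y + 1 by ring, show x + 1 + y = x + y + 1 by ring]
  push_cast
  ring

theorem geom_mul_succ_add (a b : ℝ) (x y : ℕ) :
    geom a b (x, y) * (a * ((x + 1 : ℕ) + y)) = geom a b (x + 1, y) * (x + 1 : ℕ) := by
  have h : ((x + y + 1 : ℕ) : ℝ) * ((x + y).choose x : ℝ)
      = ((x + y + 1).choose (x + 1) : ℝ) * (x + 1 : ℕ) := by
    exact_mod_cast Nat.add_one_mul_choose_eq (x + y) x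
  simp only [geom]
  rw [show x + 1 + y = x + y + 1 by ring]
  push_cast at h ⊢
  linear_combination (a ^ (x + 1) * b ^ y) * h

theorem geom_succ_left_mul (a b : ℝ) (x y : ℕ) :
    geom a b (x + 1, y) * (b * (x + 1 : ℕ)) = geom a b (x, y + 1) * (a * (y + 1 : ℕ)) := by
  have h : ((x + y + 1).choose (x + 1) : ℝ) * (x + 1 : ℕ)
      = ((x + y + 1).choose x : ℝ) * (y + 1 : ℕ) := by
    have := Nat.choose_succ_right_eq (x + y + 1) x
    rw [show x + y + 1 - x = y + 1 by omega] at this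
    exact_mod_cast this
  simp only [geom]
  rw [show x + 1 + y = x + y + 1 by ring, show x + (y + 1) = x + y + 1 by ring]
  push_cast at h ⊢
  linear_combination (a ^ (x + 1) * b ^ (y + 1)) * h

/-- By Pascal's rule each value is a convex combination of two values one level lower (on the axes,
a multiple ≤ 1 of a single one), so the maximum over a level x + y = N does not increase with N. -/
theorem geom_le_of_level {a b M : ℝ} (ha : 0 ≤ a) (hb : 0 ≤ b) (hab : a + b = 1) {N : ℕ}
    (h : ∀ x y : ℕ, x + y = N → geom a b (x, y) ≤ M) (n : ℕ) :
    ∀ x y : ℕ, x + y = N + n → geom a b (x, y) ≤ M := by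
  have hM : 0 ≤ M := (geom_nonneg ha hb _).trans (h N 0 rfl)
  have ha1 : a ≤ 1 := by linarith
  have hb1 : b ≤ 1 := by linarith
  induction n with
  | zero => exact h
  | succ n ih =>
    rintro (_ | x) (_ | y) hxy
    · omega
    · have h1 := ih 0 y (by omega)
      have h2 : geom a b (0, y + 1) = b * geom a b (0, y) := by
        simp only [geom, zero_add, Nat.choose_zero_right, pow_succ]
        ring
      rw [h2]
      exact (mul_le_of_le_one_left (geom_nonneg ha hb _) hb1).trans h1
    · have h1 := ih x 0 (by omega)
      have h2 : geom a b (x + 1, 0) = a * geom a b (x, 0) := by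
        simp only [geom, add_zero, Nat.choose_self, pow_succ]
        ring
      rw [h2]
      exact (mul_le_of_le_one_left (geom_nonneg ha hb _) ha1).trans h1
    · have h1 := mul_le_mul_of_nonneg_left (ih x (y + 1) (by omega)) ha
      have h2 := mul_le_mul_of_nonneg_left (ih (x + 1) y (by omega)) hb
      rw [geom_succ_succ]
      calc _ ≤ a * M + b * M := add_le_add h1 h2
        _ = M := by rw [← add_mul, hab, one_mul]

theorem geom_le_one {a b : ℝ} (ha : 0 ≤ a) (hb : 0 ≤ b) (hab : a + b = 1) (x y : ℕ) :
    geom a b (x, y) ≤ 1 := by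
  refine geom_le_of_level ha hb hab (N := 0) (fun x y hxy => ?_) (x + y) x y (by omega)
  obtain ⟨rfl, rfl⟩ : x = 0 ∧ y = 0 := by omega
  simp [geom]

/-- Along a level, the step from (x, y + 1) to (x + 1, y) multiplies the value by a(y + 1)/(b(x +
1)), which is at most 1 beyond (kp, kq): the latter is the mode. -/
theorem geom_le_geom_of_sum_eq {a b : ℝ} (ha : 0 ≤ a) (hb : 0 < b) {p q : ℕ}
    (hab : q * a = p * b) (k j : ℕ) :
    ∀ y : ℕ, y + j = k * q → geom a b (k * p + j, y) ≤ geom a b (k * p, k * q) := by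
  induction j with
  | zero =>
    intro y hy
    simp only [add_zero] at hy ⊢
    rw [hy]
  | succ j ih =>
    intro y hy
    refine le_trans ?_ (ih (y + 1) (by omega))
    have h := geom_succ_left_mul a b (k * p + j) y
    have hpos : 0 < b * ((k * p + j + 1 : ℕ) : ℝ) := by positivity
    have hy' : ((y + 1 : ℕ) : ℝ) ≤ k * q := by exact_mod_cast (by omega : y + 1 ≤ k * q)
    have hle : a * ((y + 1 : ℕ) : ℝ) ≤ b * ((k * p + j + 1 : ℕ) : ℝ) := by
      calc a * ((y + 1 : ℕ) : ℝ) ≤ a * (k * q) := mul_le_mul_of_nonneg_left hy' ha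
        _ = b * (k * p) := by linear_combination (k : ℝ) * hab
        _ ≤ _ := by
          refine mul_le_mul_of_nonneg_left ?_ hb.le
          push_cast
          linarith [(Nat.cast_nonneg j : (0 : ℝ) ≤ j)]
    refine le_of_mul_le_mul_right ?_ hpos
    rw [← add_assoc, h]
    exact mul_le_mul_of_nonneg_left hle (geom_nonneg ha hb.le _)

/-- The binomial probabilities are at most the central one on a lower level. -/
theorem geom_le_geom_of_le {a b : ℝ} (ha : 0 < a) (hb : 0 < b) (hab1 : a + b = 1) {p q : ℕ}
    (hab : q * a = p * b) (k : ℕ) {x y : ℕ} (hxy : k * p + k * q ≤ x + y) :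
    geom a b (x, y) ≤ geom a b (k * p, k * q) := by
  refine geom_le_of_level ha.le hb.le hab1 (N := k * p + k * q) (fun x y h => ?_)
    (x + y - (k * p + k * q)) x y (by omega)
  rcases le_total (k * p) x with hx | hx
  · obtain ⟨j, rfl⟩ := Nat.exists_eq_add_of_le hx
    exact geom_le_geom_of_sum_eq ha.le hb hab k j y (by omega)
  · obtain ⟨j, rfl⟩ := Nat.exists_eq_add_of_le (show k * q ≤ y by omega)
    rw [geom_swap, geom_swap a b (k * p)]
    exact geom_le_geom_of_sum_eq hb.le ha hab.symm k j x (by omega)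

/-- The limit of `√k` times the central binomial probability. -/
def localConst (p q : ℕ) : ℝ := √Real.pi / (√Real.pi * √Real.pi) * √((p + q) / (2 * p * q))

theorem localConst_pos {p q : ℕ} (hp : 0 < p) (hq : 0 < q) : 0 < localConst p q := by
  have := Real.pi_pos
  have hp' : (0 : ℝ) < p := by exact_mod_cast hp
  have hq' : (0 : ℝ) < q := by exact_mod_cast hq
  unfold localConst
  positivity

theorem factorial_eq_stirlingSeq_mul {n : ℕ} (hn : 0 < n) :
    (n.factorial : ℝ) = Stirling.stirlingSeq n * (√(2 * n) * (n / Real.exp 1) ^ n) := by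
  have hn' : (0 : ℝ) < n := by exact_mod_cast hn
  rw [Stirling.stirlingSeq, div_mul_cancel₀]
  positivity

/-- Stirling's formula for the three factorials. With the weights p/(p+q), q/(p+q) the powers cancel
exactly (`hpow`), leaving only the square roots. -/
theorem tendsto_sqrt_mul_geom {p q : ℕ} (hp : 0 < p) (hq : 0 < q) :
    Tendsto (fun k : ℕ => √k * geom ((p : ℝ) / (p + q)) (q / (p + q)) (k * p, k * q)) atTop
      (𝓝 (localConst p q)) := by
  have hp' : (0 : ℝ) < p := by exact_mod_cast hp
  have hq' : (0 : ℝ) < q := by exact_mod_cast hq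
  have hsub : ∀ {r : ℕ}, 0 < r →
      Tendsto (fun k : ℕ => Stirling.stirlingSeq (k * r)) atTop (𝓝 √Real.pi) := fun hr =>
    Stirling.tendsto_stirlingSeq_sqrt_pi.comp (tendsto_id.atTop_mul_const' hr)
  have hne : √Real.pi * √Real.pi ≠ 0 := by
    have := Real.pi_pos
    positivity
  refine Tendsto.congr' ?_ (((hsub (Nat.add_pos_left hp q)).div ((hsub hp).mul (hsub hq))
    hne).mul_const (√((p + q) / (2 * p * q))))
  filter_upwards [eventually_gt_atTop 0] with k hk
  have hk' : (0 : ℝ) < k := by exact_mod_cast hk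
  have hS : ∀ {r : ℕ}, 0 < r → 0 < Stirling.stirlingSeq (k * r) := fun {r} hr => by
    obtain ⟨n, hn⟩ := Nat.exists_eq_succ_of_ne_zero (Nat.mul_pos hk hr).ne'
    rw [hn]
    exact Stirling.stirlingSeq'_pos n
  have hSp := hS hp
  have hSq := hS hq
  have hchoose : ((k * p + k * q).choose (k * p) : ℝ)
      = ((k * (p + q)).factorial : ℝ) / ((k * p).factorial * (k * q).factorial) := by
    rw [Nat.cast_add_choose, mul_add]
  simp only [geom, hchoose]
  rw [factorial_eq_stirlingSeq_mul (Nat.mul_pos hk (Nat.add_pos_left hp q)),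
    factorial_eq_stirlingSeq_mul (Nat.mul_pos hk hp),
    factorial_eq_stirlingSeq_mul (Nat.mul_pos hk hq)]
  have hsq : √((p + q : ℝ) / (2 * p * q))
      = √k * √(2 * (k * (p + q) : ℕ)) / (√(2 * (k * p : ℕ)) * √(2 * (k * q : ℕ))) := by
    rw [← Real.sqrt_mul (by positivity), ← Real.sqrt_mul (by positivity),
      ← Real.sqrt_div (by positivity)]
    congr 1
    push_cast
    field_simp
  rw [hsq]
  have hpow : ((k * (p + q) : ℕ) / Real.exp 1) ^ (k * (p + q)) * ((p : ℝ) / (p + q)) ^ (k * p)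
      * ((q : ℝ) / (p + q)) ^ (k * q)
      = ((k * p : ℕ) / Real.exp 1) ^ (k * p) * ((k * q : ℕ) / Real.exp 1) ^ (k * q) := by
    rw [mul_add k p q, pow_add]
    calc _ = (((k * p + k * q : ℕ) / Real.exp 1) * ((p : ℝ) / (p + q))) ^ (k * p)
        * (((k * p + k * q : ℕ) / Real.exp 1) * ((q : ℝ) / (p + q))) ^ (k * q) := by
          rw [mul_pow, mul_pow]
          ring
      _ = _ := by
        congr 2
        · push_cast
          field_simp
        · push_cast
          field_simp
  have h34 : ((k * p : ℕ) / Real.exp 1) ^ (k * p) * ((k * q : ℕ) / Real.exp 1) ^ (k * q) ≠ 0 := by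
    positivity
  -- After the rewrite this is a quotient equal to 1 which, inserted as a factor, lets `ring` match
  -- both sides.
  have h1 := div_self h34
  nth_rewrite 1 [← hpow] at h1
  simp only [Pi.div_apply]
  refine (mul_one _).symm.trans ((congrArg (_ * ·) h1.symm).trans ?_)
  ring

theorem tendsto_linear_div_linear {p r : ℝ} (hr : r ≠ 0) (s u : ℝ) :
    Tendsto (fun k : ℕ => (k * p - s) / (k * r - u)) atTop (𝓝 (p / r)) := by
  have h : ∀ c d : ℝ, Tendsto (fun k : ℕ => c - d / (k : ℝ)) atTop (𝓝 c) := fun c d => by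
    simpa using tendsto_const_nhds.sub (tendsto_const_div_atTop_nhds_zero_nat d)
  refine ((h p s).div (h r u) hr).congr' ?_
  filter_upwards [eventually_gt_atTop 0] with k hk
  have hk' : (k : ℝ) ≠ 0 := by exact_mod_cast hk.ne'
  simp only [Pi.div_apply]
  rw [← mul_div_mul_left _ _ hk', mul_sub, mul_sub, mul_div_cancel₀ _ hk', mul_div_cancel₀ _ hk']

/-- One step to the left multiplies the probability by (kp - s)/(k(p+q) - (s+t)) divided by p/(p+q),
and this factor tends to 1. -/
theorem tendsto_geom_shift {p q : ℕ} (hp : 0 < p) {L : ℝ} {N : ℕ → ℝ} (s t : ℕ)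
    (h : Tendsto (fun k : ℕ => N k * geom ((p : ℝ) / (p + q)) (q / (p + q)) (k * p - s, k * q - t))
      atTop (𝓝 L)) (hq : 0 < q) :
    Tendsto (fun k : ℕ => N k * geom ((p : ℝ) / (p + q)) (q / (p + q))
      (k * p - (s + 1), k * q - t)) atTop (𝓝 L) := by
  have hp' : (0 : ℝ) < p := by exact_mod_cast hp
  have hpq : (0 : ℝ) < p + q := by positivity
  have hr := ((tendsto_linear_div_linear hpq.ne' s (s + t) (p := p)).div_const
    ((p : ℝ) / (p + q)))
  rw [div_self (by positivity)] at hr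
  rw [← mul_one L]
  refine (h.mul hr).congr' ?_
  filter_upwards [eventually_gt_atTop (s + t)] with k hk
  have h1 : s + 1 ≤ k * p := by nlinarith
  have h2 : t ≤ k * q := by nlinarith
  obtain ⟨x, hx⟩ := Nat.exists_eq_add_of_le h1
  obtain ⟨y, hy⟩ := Nat.exists_eq_add_of_le h2
  have e := geom_mul_succ_add ((p : ℝ) / (p + q)) (q / (p + q)) x y
  have hx' : (k : ℝ) * p = s + 1 + x := by exact_mod_cast hx
  have hy' : (k : ℝ) * q = t + y := by exact_mod_cast hy
  rw [show k * p - s = x + 1 by omega, show k * p - (s + 1) = x by omega,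
    show k * q - t = y by omega, mul_add (k : ℝ), hx', hy', mul_assoc, div_div]
  congr 1
  rw [← mul_div_assoc, div_eq_iff]
  · push_cast at e
    linear_combination -e
  · have : (0 : ℝ) < x + 1 + y := by positivity
    have h3 : (s + 1 + x + (t + y) - (s + t) : ℝ) = x + 1 + y := by ring
    rw [h3]
    positivity

theorem tendsto_sqrt_mul_geom_shift {p q : ℕ} (hp : 0 < p) (hq : 0 < q) (s t : ℕ) :
    Tendsto (fun k : ℕ => √k * geom ((p : ℝ) / (p + q)) (q / (p + q)) (k * p - s, k * q - t)) atTop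
      (𝓝 (localConst p q)) := by
  induction s with
  | succ s ih => exact tendsto_geom_shift hp s t ih hq
  | zero =>
    induction t with
    | zero => exact tendsto_sqrt_mul_geom hp hq
    | succ t ih =>
      have hsw : ∀ x y, geom ((p : ℝ) / (p + q)) (q / (p + q)) (x, y)
          = geom ((q : ℝ) / (q + p)) (p / (q + p)) (y, x) := fun x y => by
        rw [geom_swap, add_comm (q : ℝ)]
      simp only [hsw] at ih ⊢
      exact tendsto_geom_shift hq t 0 ih hp

/-- If k ≤ s + t, probabilities are at most 1 and √k ≤ s + t. Otherwise put j + 1 = k - (s + t): the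
shifted point is on a level no lower than (j+1)(p+q), so the central value there dominates, and √k ≤
(s + t + 1)√(j + 1). -/
theorem exists_sqrt_mul_geom_le {p q : ℕ} (hp : 0 < p) (hq : 0 < q) :
    ∃ C : ℝ, 0 ≤ C ∧ ∀ k s t : ℕ, s ≤ k * p → t ≤ k * q →
      √k * geom ((p : ℝ) / (p + q)) (q / (p + q)) (k * p - s, k * q - t) ≤ C * (s + t + 1) := by
  have hp' : (0 : ℝ) < p := by exact_mod_cast hp
  have hq' : (0 : ℝ) < q := by exact_mod_cast hq
  have hα : 0 < (p : ℝ) / (p + q) := by positivity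
  have hβ : 0 < (q : ℝ) / (p + q) := by positivity
  have hαβ : (p : ℝ) / (p + q) + q / (p + q) = 1 := by field_simp
  have hmode : (q : ℝ) * (p / (p + q)) = p * (q / (p + q)) := by ring
  obtain ⟨C, hC⟩ := (tendsto_sqrt_mul_geom hp hq).bddAbove_range
  refine ⟨max C 1, by positivity, fun k s t hs ht => ?_⟩
  have hu : (0 : ℝ) ≤ s + t := by positivity
  rcases le_or_gt k (s + t) with hk | hk
  · have hk1 : √(k : ℝ) ≤ k := by
      rw [Real.sqrt_le_left (by positivity)]
      exact_mod_cast Nat.le_self_pow two_ne_zero k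
    have hk2 : (k : ℝ) ≤ s + t := by exact_mod_cast hk
    calc _ ≤ √(k : ℝ) := mul_le_of_le_one_right (by positivity) (geom_le_one hα.le hβ.le hαβ _ _)
      _ ≤ 1 * (s + t + 1) := by linarith
      _ ≤ _ := mul_le_mul_of_nonneg_right (le_max_right _ _) (by positivity)
  · obtain ⟨j, hj⟩ := Nat.exists_eq_add_of_lt hk
    have hle : geom ((p : ℝ) / (p + q)) (q / (p + q)) (k * p - s, k * q - t)
        ≤ geom ((p : ℝ) / (p + q)) (q / (p + q)) ((j + 1) * p, (j + 1) * q) := by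
      refine geom_le_geom_of_le hα hβ hαβ hmode (j + 1) ?_
      have e1 : k * p = (j + 1) * p + (s + t) * p := by rw [hj]; ring
      have e2 : k * q = (j + 1) * q + (s + t) * q := by rw [hj]; ring
      have e3 : s + t ≤ (s + t) * p := Nat.le_mul_of_pos_right _ hp
      omega
    have hsq : √(k : ℝ) ≤ (s + t + 1) * √((j + 1 : ℕ) : ℝ) := by
      rw [Real.sqrt_le_left (by positivity), mul_pow, Real.sq_sqrt (by positivity), hj]
      push_cast
      have hj0 : (0 : ℝ) ≤ j := by positivity
      nlinarith [mul_nonneg hu hj0, mul_nonneg hu hu, mul_nonneg (mul_nonneg hu hu) hj0]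
    calc _ ≤ ((s + t + 1) * √((j + 1 : ℕ) : ℝ)) * _ :=
          mul_le_mul hsq hle (geom_nonneg hα.le hβ.le _) (by positivity)
      _ = (√((j + 1 : ℕ) : ℝ) * _) * (s + t + 1) := by ring
      _ ≤ C * (s + t + 1) :=
          mul_le_mul_of_nonneg_right (hC ⟨j + 1, rfl⟩) (by positivity)
      _ ≤ _ := mul_le_mul_of_nonneg_right (le_max_left _ _) (by positivity)

end LocalLimit

/-! ### Convolution of two binomial arrays through negative binomial distribution functions. -/

section CornerLimit

/-- Bernoulli's inequality on both factors leaves the first-order term (qc - p)ε. Used both for the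
Chernoff bound and to move uphill inside the polygon. -/
theorem eventually_one_lt_pow_mul_pow {p q : ℕ} {c : ℝ} (hc : 0 < c) (h : (p : ℝ) < q * c) :
    ∀ᶠ ε : ℝ in 𝓝[>] 0, 1 < (1 - ε) ^ p * (1 + c * ε) ^ q := by
  have hcont : Continuous fun ε : ℝ => (q * c - p - p * (q * c) * ε : ℝ) := by fun_prop
  have h0 : ∀ᶠ ε : ℝ in 𝓝[>] 0, 0 < (q * c - p - p * (q * c) * ε : ℝ) :=
    ((hcont.tendsto 0).eventually (lt_mem_nhds (by simpa using h))).filter_mono nhdsWithin_le_nhds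
  filter_upwards [h0, Ioo_mem_nhdsGT (zero_lt_one' ℝ)] with ε h1 hε
  have e1 : 1 + p * -ε ≤ (1 + -ε) ^ p := one_add_mul_le_pow (by linarith [hε.2]) p
  have e2 : 1 + q * (c * ε) ≤ (1 + c * ε) ^ q :=
    one_add_mul_le_pow (by linarith [mul_pos hc hε.1]) q
  have e3 : 0 ≤ q * (c * ε) := by
    have := hε.1
    positivity
  calc (1 : ℝ) < 1 + ε * (q * c - p - p * (q * c) * ε) := by
        linarith [mul_pos hε.1 h1]
    _ = (1 + p * -ε) * (1 + q * (c * ε)) := by ring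
    _ ≤ (1 + -ε) ^ p * (1 + c * ε) ^ q :=
      mul_le_mul e1 e2 (by linarith) (pow_nonneg (by linarith [hε.2]) p)
    _ = _ := by rw [← sub_eq_add_neg]

theorem conv_nonneg {f g : ℕ × ℕ → ℝ} (hf : ∀ n, 0 ≤ f n) (hg : ∀ n, 0 ≤ g n) (n : ℕ × ℕ) :
    0 ≤ conv f g n :=
  Finset.sum_nonneg fun k _ => mul_nonneg (hf k) (hg _)

/-- The coefficients of `b / ((1 - z) (1 - a z - b w))`: for `a + b = 1`, the distribution
function of a negative binomial law. -/
def cumul (a b : ℝ) (n : ℕ × ℕ) : ℝ := b * conv (geom 1 0) (geom a b) n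

theorem cumul_nonneg {a b : ℝ} (ha : 0 ≤ a) (hb : 0 ≤ b) (n : ℕ × ℕ) : 0 ≤ cumul a b n :=
  mul_nonneg hb (conv_nonneg (geom_nonneg zero_le_one le_rfl) (geom_nonneg ha hb) n)

theorem genSum_cumul {a b : ℝ} {v : ℝ × ℝ} (h1 : ‖v.1‖ < 1) (h : ‖a * v.1‖ + ‖b * v.2‖ < 1) :
    GenSum (cumul a b) v (b * ((1 - v.1)⁻¹ * (1 - a * v.1 - b * v.2)⁻¹)) := by
  have hg : GenSum (geom (1 : ℝ) 0) v (1 - v.1)⁻¹ := by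
    simpa using genSum_geom (a := (1 : ℝ)) (b := 0) (v := v) (by simpa using h1)
  exact (hg.mul_conv (genSum_geom h)).const_mul b

theorem genSum_one {v : ℝ × ℝ} (h1 : ‖v.1‖ < 1) (h2 : ‖v.2‖ < 1) :
    GenSum (fun _ => (1 : ℝ)) v ((1 - v.1)⁻¹ * (1 - v.2)⁻¹) := by
  have e1 := hasSum_geometric_of_norm_lt_one h1
  have e2 := hasSum_geometric_of_norm_lt_one h2
  have := e1.mul e2 (summable_mul_of_summable_norm e1.summable.norm e2.summable.norm)
  simpa only [GenSum, one_mul, monom] using this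

theorem GenSum.swap {f : ℕ × ℕ → ℝ} {v : ℝ × ℝ} {s : ℝ} (h : GenSum f v.swap s) :
    GenSum (fun n => f n.swap) v s := by
  have := (Equiv.prodComm ℕ ℕ).hasSum_iff.2 h
  refine HasSum.congr_fun this fun n => ?_
  simp only [monom, Function.comp, Equiv.prodComm_apply, Prod.fst_swap, Prod.snd_swap]
  ring

/-- On generating functions this is b(1 - w) + a(1 - z) = 1 - az - bw. Probabilistically, of two
complementary events exactly one occurs. -/
theorem cumul_add_cumul_swap {a b : ℝ} (hab : a + b = 1) (n : ℕ × ℕ) :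
    cumul a b n + cumul b a n.swap = 1 := by
  refine congrFun (eq_of_eventually_genSum (f := fun n => cumul a b n + cumul b a n.swap)
    (g := fun _ => (1 : ℝ))
    (φ := fun v => (1 - v.1)⁻¹ * (1 - v.2)⁻¹) ?_ ?_) n
  · filter_upwards [eventually_norm_add_norm_lt_one a b, eventually_norm_add_norm_lt_one (1 : ℝ) 1]
      with v h h1
    simp only [one_mul] at h1
    have hv1 : ‖v.1‖ < 1 := by linarith [norm_nonneg v.2]
    have hv2 : ‖v.2‖ < 1 := by linarith [norm_nonneg v.1]
    convert! (genSum_cumul hv1 h).add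
      (GenSum.swap (genSum_cumul (v := v.swap) hv2 (by rw [add_comm]; exact h))) using 1
    have d1 : 1 - v.1 ≠ 0 := by linarith [(abs_lt.1 hv1).2]
    have d2 : 1 - v.2 ≠ 0 := by linarith [(abs_lt.1 hv2).2]
    have d3 : 1 - a * v.1 - b * v.2 ≠ 0 := by
      have := le_abs_self (a * v.1)
      have := le_abs_self (b * v.2)
      simp only [Real.norm_eq_abs] at h
      linarith
    simp only [Prod.fst_swap, Prod.snd_swap]
    rw [sub_right_comm 1 (b * v.2)]
    generalize hD : 1 - a * v.1 - b * v.2 = D at d3 ⊢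
    field_simp
    rw [← hD]
    linear_combination -hab
  · filter_upwards [eventually_norm_add_norm_lt_one (1 : ℝ) 1] with v h1
    simp only [one_mul] at h1
    exact genSum_one (by linarith [norm_nonneg v.2]) (by linarith [norm_nonneg v.1])

theorem cumul_le_one {a b : ℝ} (ha : 0 ≤ a) (hb : 0 ≤ b) (hab : a + b = 1) (n : ℕ × ℕ) :
    cumul a b n ≤ 1 := by
  linarith [cumul_add_cumul_swap hab n, cumul_nonneg hb ha n.swap]

/-- Chernoff bound: a nonnegative coefficient times the monomial at (1 - ε, 1 + cε) is at most the
sum of the series there. Taking c < a/b keeps this point in the domain of convergence, while c > p/q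
makes the monomial grow geometrically along the ray. -/
theorem tendsto_cumul_zero {a b : ℝ} (ha : 0 < a) (hb : 0 < b) (hab : a + b = 1) {p q : ℕ}
    (hp : 0 < p) (hq : 0 < q) (h : p * b < q * a) (s t : ℕ) :
    Tendsto (fun k : ℕ => cumul a b (k * p - s, k * q - t)) atTop (𝓝 0) := by
  have hq' : (0 : ℝ) < q := by exact_mod_cast hq
  obtain ⟨c, hc1, hc2⟩ : ∃ c : ℝ, (p : ℝ) / q < c ∧ c < a / b :=
    exists_between (by rwa [div_lt_div_iff₀ hq' hb, mul_comm a])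
  have hc : 0 < c := lt_of_le_of_lt (by positivity) hc1
  rw [div_lt_iff₀ hq', mul_comm] at hc1
  rw [lt_div_iff₀ hb] at hc2
  obtain ⟨ε, hθ, hε⟩ := ((eventually_one_lt_pow_mul_pow hc hc1).and
    (Ioo_mem_nhdsGT (zero_lt_one' ℝ))).exists
  have hz : 0 < 1 - ε := by linarith [hε.2]
  have hw : 0 < 1 + c * ε := by linarith [mul_pos hc hε.1]
  have hsum : a * (1 - ε) + b * (1 + c * ε) < 1 := by
    nlinarith [mul_pos hε.1 (sub_pos.2 hc2)]
  have hgen := genSum_cumul (a := a) (b := b) (v := (1 - ε, 1 + c * ε))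
    (by rw [Real.norm_of_nonneg hz.le]; linarith [hε.1])
    (by rwa [Real.norm_of_nonneg (by positivity), Real.norm_of_nonneg (by positivity)])
  set S := b * ((1 - (1 - ε, 1 + c * ε).1)⁻¹ *
    (1 - a * (1 - ε, 1 + c * ε).1 - b * (1 - ε, 1 + c * ε).2)⁻¹)
  set θ := (1 - ε) ^ p * (1 + c * ε) ^ q with hθdef
  have hlim : Tendsto (fun k : ℕ => S * ((1 - ε) ^ s * (1 + c * ε) ^ t) * (θ⁻¹) ^ k) atTop (𝓝 0) := by
    simpa using (tendsto_pow_atTop_nhds_zero_of_lt_one (by positivity)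
      (inv_lt_one_of_one_lt₀ hθ)).const_mul (S * ((1 - ε) ^ s * (1 + c * ε) ^ t))
  refine squeeze_zero' (Eventually.of_forall fun k => cumul_nonneg ha.le hb.le _) ?_ hlim
  filter_upwards [eventually_ge_atTop (s + t)] with k hk
  have hle := le_hasSum hgen (k * p - s, k * q - t) fun n _ =>
    mul_nonneg (cumul_nonneg ha.le hb.le n) (by unfold monom; positivity)
  have hs : s ≤ k * p := by nlinarith
  have ht : t ≤ k * q := by nlinarith
  have e : monom (1 - ε, 1 + c * ε) (k * p - s, k * q - t) * ((1 - ε) ^ s * (1 + c * ε) ^ t)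
      = θ ^ k := by
    simp only [monom]
    rw [mul_mul_mul_comm, ← pow_add, ← pow_add, Nat.sub_add_cancel hs, Nat.sub_add_cancel ht,
      hθdef, mul_pow, ← pow_mul, ← pow_mul, mul_comm p, mul_comm q]
  rw [inv_pow, ← div_eq_mul_inv, le_div_iff₀ (by positivity), ← e, ← mul_assoc]
  exact mul_le_mul_of_nonneg_right hle (by positivity)

theorem tendsto_cumul_one {a b : ℝ} (ha : 0 < a) (hb : 0 < b) (hab : a + b = 1) {p q : ℕ}
    (hp : 0 < p) (hq : 0 < q) (h : q * a < p * b) (s t : ℕ) :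
    Tendsto (fun k : ℕ => cumul a b (k * p - s, k * q - t)) atTop (𝓝 1) := by
  have := (tendsto_cumul_zero hb ha (by rwa [add_comm]) hq hp h t s).const_sub 1
  rw [sub_zero] at this
  refine this.congr fun k => ?_
  rw [← cumul_add_cumul_swap hab (k * p - s, k * q - t), Prod.swap_prod_mk, add_sub_cancel_right]

/-- Partial fractions: both lines pass through (1, 1), so b₁Q₂ - b₂Q₁ = (b₁ - b₂)(1 - z). -/
theorem sub_mul_conv_geom {a₁ b₁ a₂ b₂ : ℝ} (h₁ : a₁ + b₁ = 1) (h₂ : a₂ + b₂ = 1) (n : ℕ × ℕ) :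
    (b₁ - b₂) * conv (geom a₁ b₁) (geom a₂ b₂) n = cumul a₁ b₁ n - cumul a₂ b₂ n := by
  refine congrFun (eq_of_eventually_genSum
    (f := fun n => (b₁ - b₂) * conv (geom a₁ b₁) (geom a₂ b₂) n)
    (g := fun n => cumul a₁ b₁ n - cumul a₂ b₂ n)
    (φ := fun v => (b₁ - b₂) * ((1 - a₁ * v.1 - b₁ * v.2)⁻¹ * (1 - a₂ * v.1 - b₂ * v.2)⁻¹))
    ?_ ?_) n
  · filter_upwards [eventually_norm_add_norm_lt_one a₁ b₁, eventually_norm_add_norm_lt_one a₂ b₂]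
      with v e1 e2
    exact ((genSum_geom e1).mul_conv (genSum_geom e2)).const_mul _
  · filter_upwards [eventually_norm_add_norm_lt_one a₁ b₁, eventually_norm_add_norm_lt_one a₂ b₂,
      eventually_norm_add_norm_lt_one (1 : ℝ) 0] with v e1 e2 e3
    have hv1 : ‖v.1‖ < 1 := by simpa using e3
    convert! (genSum_cumul hv1 e1).sub (genSum_cumul hv1 e2) using 1
    have d1 : 1 - v.1 ≠ 0 := by linarith [(abs_lt.1 hv1).2]
    have d : ∀ {a b : ℝ}, ‖a * v.1‖ + ‖b * v.2‖ < 1 → 1 - a * v.1 - b * v.2 ≠ 0 := by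
      intro a b h
      have := le_abs_self (a * v.1)
      have := le_abs_self (b * v.2)
      simp only [Real.norm_eq_abs] at h
      linarith
    have d2 := d e1
    have d3 := d e2
    generalize hD : 1 - a₁ * v.1 - b₁ * v.2 = D at d2 ⊢
    generalize hD' : 1 - a₂ * v.1 - b₂ * v.2 = D' at d3 ⊢
    field_simp
    rw [← hD, ← hD']
    linear_combination (b₁ * v.1) * h₂ - (b₂ * v.1) * h₁

theorem conv_geom_le {a₁ b₁ a₂ b₂ : ℝ} (ha₁ : 0 ≤ a₁) (hb₁ : 0 ≤ b₁) (ha₂ : 0 ≤ a₂) (hb₂ : 0 ≤ b₂)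
    (h₁ : a₁ + b₁ = 1) (h₂ : a₂ + b₂ = 1) (hb : b₁ ≠ b₂) (n : ℕ × ℕ) :
    |conv (geom a₁ b₁) (geom a₂ b₂) n| ≤ |b₁ - b₂|⁻¹ := by
  rw [← one_div, le_div_iff₀ (abs_pos.2 (sub_ne_zero.2 hb)), mul_comm, ← abs_mul,
    sub_mul_conv_geom h₁ h₂, abs_sub_le_iff]
  have := cumul_nonneg ha₁ hb₁ n
  have := cumul_nonneg ha₂ hb₂ n
  have := cumul_le_one ha₁ hb₁ h₁ n
  have := cumul_le_one ha₂ hb₂ h₂ n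
  constructor <;> linarith

/-- The opposite signs send one distribution function to 1 and the other to 0; the one tending to 1
has the larger b, whence the absolute value. -/
theorem tendsto_conv_geom {a₁ b₁ a₂ b₂ : ℝ} (ha₁ : 0 < a₁) (hb₁ : 0 < b₁) (ha₂ : 0 < a₂)
    (hb₂ : 0 < b₂) (h₁ : a₁ + b₁ = 1) (h₂ : a₂ + b₂ = 1) {p q : ℕ} (hp : 0 < p) (hq : 0 < q)
    (h : (p * b₁ - q * a₁) * (p * b₂ - q * a₂) < 0) (s t : ℕ) :
    Tendsto (fun k : ℕ => conv (geom a₁ b₁) (geom a₂ b₂) (k * p - s, k * q - t)) atTop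
      (𝓝 |b₁ - b₂|⁻¹) := by
  have hp' : (0 : ℝ) < p := by exact_mod_cast hp
  have hq' : (0 : ℝ) < q := by exact_mod_cast hq
  have hb : ∀ {a a' b b' : ℝ}, a + b = 1 → a' + b' = 1 → 0 < p * b - q * a →
      p * b' - q * a' < 0 → b' < b := by
    intro a a' b b' e e' i i'
    obtain rfl : a = 1 - b := by linarith
    obtain rfl : a' = 1 - b' := by linarith
    have : 0 < (b - b') * (p + q) := by linarith
    linarith [pos_of_mul_pos_left this (by positivity)]
  have hconv : ∀ n, b₁ - b₂ ≠ 0 → conv (geom a₁ b₁) (geom a₂ b₂) n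
      = (cumul a₁ b₁ n - cumul a₂ b₂ n) / (b₁ - b₂) := fun n hne => by
    rw [eq_div_iff hne, mul_comm, sub_mul_conv_geom h₁ h₂]
  rcases mul_neg_iff.1 h with ⟨i1, i2⟩ | ⟨i1, i2⟩
  · have hlt := sub_pos.2 (hb h₁ h₂ i1 i2)
    rw [abs_of_pos hlt]
    simp only [hconv _ hlt.ne']
    have := ((tendsto_cumul_one ha₁ hb₁ h₁ hp hq (by linarith) s t).sub
      (tendsto_cumul_zero ha₂ hb₂ h₂ hp hq (by linarith) s t)).div_const (b₁ - b₂)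
    rwa [sub_zero, one_div] at this
  · have hlt := sub_neg.2 (hb h₂ h₁ i2 i1)
    rw [abs_of_neg hlt]
    simp only [hconv _ hlt.ne]
    have := ((tendsto_cumul_zero ha₁ hb₁ h₁ hp hq (by linarith) s t).sub
      (tendsto_cumul_one ha₂ hb₂ h₂ hp hq (by linarith) s t)).div_const (b₁ - b₂)
    rwa [zero_sub, neg_div, ← div_neg, one_div] at this

end CornerLimit

/-! ### From the limits of the model arrays to the coefficients of P/Q. -/

section Asymptotics

variable {m : ℕ}

theorem exists_genSum_evalAt (P : MvPolynomial (Fin 2) ℂ) :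
    ∃ c : ℕ × ℕ → ℂ, ∀ v : ℂ × ℂ, GenSum c v (evalAt P v.1 v.2) := by
  induction P using MvPolynomial.induction_on' with
  | monomial u x =>
    refine ⟨fun n => if n = (u 0, u 1) then x else 0, fun v => ?_⟩
    have h : GenSum (fun n => if n = (u 0, u 1) then x else 0) v _ :=
      hasSum_single (f := fun n => (if n = (u 0, u 1) then x else 0) * monom v n)
        (u 0, u 1) fun n hn => by rw [if_neg hn, zero_mul]
    convert! h using 1
    rw [evalAt, MvPolynomial.eval_monomial, Finsupp.prod_fintype _ _ fun _ => pow_zero _]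
    simp [monom]
  | add P Q hP hQ =>
    obtain ⟨c, hc⟩ := hP
    obtain ⟨d, hd⟩ := hQ
    refine ⟨fun n => c n + d n, fun v => ?_⟩
    have e : evalAt (P + Q) v.1 v.2 = evalAt P v.1 v.2 + evalAt Q v.1 v.2 := map_add _ _ _
    rw [e]
    exact (hc v).add (hd v)

theorem evalAt_linFactor (a b : Fin m → ℝ) (i : Fin m) (z w : ℂ) :
    evalAt (linFactor a b i) z w = 1 - a i * z - b i * w := by
  simp [evalAt, linFactor]

theorem evalAt_denom (a b : Fin m → ℝ) (z w : ℂ) :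
    evalAt (denom a b) z w = ∏ i, (1 - a i * z - b i * w) := by
  rw [evalAt, denom, map_prod]
  exact Finset.prod_congr rfl fun i _ => evalAt_linFactor a b i z w

theorem exists_genSum_prod_inv (a b : Fin m → ℝ) (s : Finset (Fin m)) :
    ∃ c : ℕ × ℕ → ℂ, ∀ v : ℂ × ℂ, (∀ i ∈ s, ‖(a i : ℂ) * v.1‖ + ‖(b i : ℂ) * v.2‖ < 1) →
      GenSum c v (∏ i ∈ s, (1 - a i * v.1 - b i * v.2))⁻¹ := by
  induction s using Finset.induction_on with
  | empty =>
    obtain ⟨c, hc⟩ := exists_genSum_evalAt 1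
    exact ⟨c, fun v _ => by simpa [evalAt] using hc v⟩
  | insert i s hi ih =>
    obtain ⟨c, hc⟩ := ih
    refine ⟨conv (geom (a i : ℂ) (b i)) c, fun v hv => ?_⟩
    rw [Finset.prod_insert hi, mul_inv]
    exact (genSum_geom (hv i (Finset.mem_insert_self i s))).mul_conv
      (hc v fun j hj => hv j (Finset.mem_insert_of_mem hj))

/-- Factoring the Taylor series of `P / Q` into that of `P / ∏_{l ∉ T} Q_l` and that of
`1 / ∏_{l ∈ T} Q_l`. -/
theorem IsTaylorCoeff.exists_eq_conv {a b : Fin m → ℝ} {P : MvPolynomial (Fin 2) ℂ}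
    {f : ℕ → ℕ → ℂ} (hf : IsTaylorCoeff P (denom a b) f) (T : Finset (Fin m)) {h : ℕ × ℕ → ℂ}
    (hh : ∀ᶠ v : ℂ × ℂ in 𝓝 0, GenSum h v (∏ i ∈ T, (1 - a i * v.1 - b i * v.2))⁻¹) :
    ∃ g : ℕ × ℕ → ℂ, (fun n => f n.1 n.2) = conv g h ∧
      ∀ v : ℂ × ℂ, (∀ i ∉ T, ‖(a i : ℂ) * v.1‖ + ‖(b i : ℂ) * v.2‖ < 1) →
        GenSum g v (evalAt P v.1 v.2 * (∏ i ∈ Tᶜ, (1 - a i * v.1 - b i * v.2))⁻¹) := by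
  obtain ⟨c, hc⟩ := exists_genSum_evalAt P
  obtain ⟨d, hd⟩ := exists_genSum_prod_inv a b Tᶜ
  have hg : ∀ v : ℂ × ℂ, (∀ i ∉ T, ‖(a i : ℂ) * v.1‖ + ‖(b i : ℂ) * v.2‖ < 1) →
      GenSum (conv c d) v (evalAt P v.1 v.2 * (∏ i ∈ Tᶜ, (1 - a i * v.1 - b i * v.2))⁻¹) :=
    fun v hv => (hc v).mul_conv (hd v fun i hi => hv i (Finset.mem_compl.1 hi))
  refine ⟨conv c d, ?_, hg⟩
  refine eq_of_eventually_genSum (φ := fun v => evalAt P v.1 v.2 / evalAt (denom a b) v.1 v.2) ?_ ?_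
  · filter_upwards [hf] with v hv
    simpa only [GenSum, monom, mul_assoc] using hv
  · have hnear : ∀ᶠ v : ℂ × ℂ in 𝓝 0, ∀ i, ‖(a i : ℂ) * v.1‖ + ‖(b i : ℂ) * v.2‖ < 1 :=
      eventually_all.2 fun i => eventually_norm_add_norm_lt_one _ _
    filter_upwards [hnear, hh] with v hv hhv
    have := (hg v fun i _ => hv i).mul_conv hhv
    rwa [mul_assoc, ← mul_inv, Finset.prod_compl_mul_prod, ← div_eq_mul_inv, ← evalAt_denom] at this

/-- Convergence at (1 + ε)v pays for the linear weight, since (1 + ε)^n ≥ 1 + nε. -/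
theorem GenSum.summable_norm_mul_linear {g : ℕ × ℕ → ℂ} {v : ℂ × ℂ} {ε : ℝ} (hε : 0 < ε)
    (hε1 : ε ≤ 1) {S : ℂ} (h : GenSum g ((1 + ε) * v.1, (1 + ε) * v.2) S) :
    Summable fun n : ℕ × ℕ => ‖g n * monom v n‖ * (n.1 + n.2 + 1) := by
  have hs : Summable fun n => ‖g n * monom ((1 + ε) * v.1, (1 + ε) * v.2) n‖ :=
    (HasSum.summable h).norm
  refine Summable.of_nonneg_of_le (fun n => by positivity) (fun n => ?_) (hs.mul_left ε⁻¹)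
  have e1 : monom ((1 + ε) * v.1, (1 + ε) * v.2) n
      = monom v n * (((1 + ε) ^ (n.1 + n.2) : ℝ) : ℂ) := by
    simp only [monom, mul_pow, pow_add]
    push_cast
    ring
  have e2 : (1 : ℝ) + (n.1 + n.2 : ℕ) * ε ≤ (1 + ε) ^ (n.1 + n.2) :=
    one_add_mul_le_pow (by linarith) _
  rw [e1, ← mul_assoc, norm_mul (g n * monom v n), Complex.norm_real,
    Real.norm_of_nonneg (by positivity), mul_left_comm]
  refine mul_le_mul_of_nonneg_left ?_ (norm_nonneg _)
  rw [inv_mul_eq_div, le_div_iff₀ hε]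
  push_cast at e2
  nlinarith

theorem ofReal_conv (f g : ℕ × ℕ → ℝ) (n : ℕ × ℕ) :
    ((conv f g n : ℝ) : ℂ) = conv (fun k => (f k : ℂ)) (fun k => (g k : ℂ)) n := by
  simp [conv]

theorem ofReal_geom (a b : ℝ) (n : ℕ × ℕ) : ((geom a b n : ℝ) : ℂ) = geom (a : ℂ) b n := by
  simp [geom]

theorem ofReal_monom (v : ℝ × ℝ) (n : ℕ × ℕ) :
    ((monom v n : ℝ) : ℂ) = monom ((v.1 : ℂ), (v.2 : ℂ)) n := by
  simp [monom]

/-- The transfer common to smooth points and corners: only the limit and the linear bound for the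
rescaled array `H` differ between them. -/
theorem tendsto_of_isTaylorCoeff {a b : Fin m → ℝ} (ha : ∀ i, 0 < a i) (hb : ∀ i, 0 < b i)
    {P : MvPolynomial (Fin 2) ℂ} {f : ℕ → ℕ → ℂ} (hf : IsTaylorCoeff P (denom a b) f)
    (T : Finset (Fin m)) {h H : ℕ × ℕ → ℝ}
    (hh : ∀ᶠ u : ℂ × ℂ in 𝓝 0,
      GenSum (fun n => (h n : ℂ)) u (∏ i ∈ T, (1 - a i * u.1 - b i * u.2))⁻¹)
    {v : ℝ × ℝ} (hv1 : 0 < v.1) (hv2 : 0 < v.2) (hH : ∀ n, h n * monom v n = H n)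
    (hQ : ∀ i ∉ T, 0 < 1 - a i * v.1 - b i * v.2)
    {p q : ℕ} (hp : 0 < p) (hq : 0 < q) {N : ℕ → ℝ} {L C : ℝ} (hC : 0 ≤ C)
    (hlim : ∀ s t : ℕ, Tendsto (fun k => N k * H (k * p - s, k * q - t)) atTop (𝓝 L))
    (hbound : ∀ k s t : ℕ, s ≤ k * p → t ≤ k * q →
      |N k * H (k * p - s, k * q - t)| ≤ C * (s + t + 1)) :
    Tendsto (fun k : ℕ => (N k : ℂ) * (f (k * p) (k * q) * ((v.1 : ℂ) ^ (k * p) * (v.2 : ℂ) ^ (k * q))))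
      atTop (𝓝 ((L : ℂ) * (evalAtReal P v *
        ((∏ i ∈ Tᶜ, (1 - a i * v.1 - b i * v.2) : ℝ) : ℂ)⁻¹))) := by
  obtain ⟨g, hg, hgsum⟩ := hf.exists_eq_conv T hh
  set u : ℂ × ℂ := ((v.1 : ℂ), (v.2 : ℂ)) with hu
  have hnorm : ∀ i, ∀ r : ℝ, 0 < r → ‖(a i : ℂ) * (r * v.1)‖ + ‖(b i : ℂ) * (r * v.2)‖
      = r * (a i * v.1 + b i * v.2) := fun i r hr => by
    simp only [norm_mul, Complex.norm_real, Real.norm_eq_abs, abs_of_pos (ha i), abs_of_pos (hb i),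
      abs_of_pos hv1, abs_of_pos hv2, abs_of_pos hr]
    ring
  obtain ⟨ε, hε, hε01⟩ : ∃ ε : ℝ, (∀ i ∉ T, (1 + ε) * (a i * v.1 + b i * v.2) < 1) ∧
      ε ∈ Set.Ioo (0 : ℝ) 1 := by
    refine Eventually.exists (f := 𝓝[>] 0) (Eventually.and ?_ (Ioo_mem_nhdsGT one_pos))
    refine eventually_all.2 fun i => ?_
    by_cases hi : i ∈ T
    · exact Eventually.of_forall fun _ h => absurd hi h
    · have hc : Continuous fun ε : ℝ => (1 + ε) * (a i * v.1 + b i * v.2) := by fun_prop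
      have h1 := hQ i hi
      exact (((hc.tendsto 0).eventually (gt_mem_nhds (by linarith))).filter_mono
        nhdsWithin_le_nhds).mono fun _ h _ => h
  have hsum := hgsum u fun i hi => by
    have := hnorm i 1 one_pos
    have h1 := hQ i hi
    simp only [Complex.ofReal_one, one_mul] at this
    rw [hu, this]
    linarith
  have hB := GenSum.summable_norm_mul_linear hε01.1 hε01.2.le (v := u)
    (hgsum ((1 + ε) * u.1, (1 + ε) * u.2) fun i hi => by
      have := hnorm i (1 + ε) (by linarith [hε01.1])
      push_cast at this
      rw [hu, this]
      exact hε i hi)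
  have key := tendsto_conv (g := fun n => g n * monom u n) (h := fun n => (H n : ℂ))
    (N := fun k => (N k : ℂ)) (L := (L : ℂ)) (B := fun n => C * (n.1 + n.2 + 1)) hsum
    ((hB.mul_left C).congr fun n => by ring) (fun n => by positivity)
    (fun s t => by exact_mod_cast (Complex.continuous_ofReal.tendsto L).comp (hlim s t))
    (fun k s t hs ht => by
      rw [← Complex.ofReal_mul, Complex.norm_real]
      exact hbound k s t hs ht) hp hq
  have e : (∏ i ∈ Tᶜ, (1 - (a i : ℂ) * u.1 - b i * u.2))
      = ((∏ i ∈ Tᶜ, (1 - a i * v.1 - b i * v.2) : ℝ) : ℂ) := by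
    push_cast
    rfl
  rw [e] at key
  refine key.congr fun k => ?_
  have e1 : f (k * p) (k * q) = conv g (fun n => (h n : ℂ)) (k * p, k * q) :=
    congrFun hg (k * p, k * q)
  have e2 : (v.1 : ℂ) ^ (k * p) * (v.2 : ℂ) ^ (k * q) = monom u (k * p, k * q) := rfl
  rw [e1, e2, conv_mul_monom]
  congr 2
  funext n
  rw [← hH n, Complex.ofReal_mul, ofReal_monom]

theorem diagonalAsymptotics_of_tendsto {f : ℕ → ℕ → ℂ} {P : MvPolynomial (Fin 2) ℂ} {p q : ℕ}
    {v : ℝ × ℝ} (hv1 : v.1 ≠ 0) (hv2 : v.2 ≠ 0) {N : ℕ → ℝ} (hN : ∀ᶠ k in atTop, N k ≠ 0) {c : ℝ}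
    (hc : c ≠ 0) (hP : evalAtReal P v ≠ 0)
    (h : Tendsto (fun k : ℕ => (N k : ℂ) *
      (f (k * p) (k * q) * ((v.1 : ℂ) ^ (k * p) * (v.2 : ℂ) ^ (k * q)))) atTop
      (𝓝 (c * evalAtReal P v / (v.1 * v.2)))) :
    DiagonalAsymptotics f P p q (fun k => c / N k) v := by
  have z1 : (v.1 : ℂ) ≠ 0 := by exact_mod_cast hv1
  have z2 : (v.2 : ℂ) ≠ 0 := by exact_mod_cast hv2
  have z3 : (c : ℂ) ≠ 0 := by exact_mod_cast hc
  rw [DiagonalAsymptotics, isEquivalent_iff_tendsto_one]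
  · have hlim : (c * evalAtReal P v / (v.1 * v.2)) ≠ (0 : ℂ) := by positivity
    have := h.div_const (c * evalAtReal P v / (v.1 * v.2) : ℂ)
    rw [div_self hlim] at this
    refine this.congr' ?_
    filter_upwards [hN] with k hk
    have z4 : (N k : ℂ) ≠ 0 := by exact_mod_cast hk
    simp only [Pi.div_apply]
    push_cast
    rw [pow_succ, pow_succ]
    field_simp
  · filter_upwards [hN] with k hk
    have z4 : (N k : ℂ) ≠ 0 := by exact_mod_cast hk
    push_cast
    positivity

/-- The value of `Q_i` at a point of the real plane. -/
def realFactor (a b : Fin m → ℝ) (i : Fin m) (v : ℝ × ℝ) : ℝ := 1 - a i * v.1 - b i * v.2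

/-- The constant in the asymptotics at a smooth point. -/
def smoothConst (a b : Fin m → ℝ) (i : Fin m) (p q : ℕ) : ℝ :=
  localConst p q * ((critPt a b i (p, q)).1 * (critPt a b i (p, q)).2) *
    (∏ l ∈ {i}ᶜ, realFactor a b l (critPt a b i (p, q)))⁻¹

/-- The constant in the asymptotics at a corner. -/
def cornerConst (a b : Fin m → ℝ) (i j : Fin m) : ℝ :=
  |b i * (interPt a b i j).2 - b j * (interPt a b i j).2|⁻¹ *
    ((interPt a b i j).1 * (interPt a b i j).2) *
    (∏ l ∈ {i, j}ᶜ, realFactor a b l (interPt a b i j))⁻¹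

theorem eventually_genSum_geom_singleton {a b : Fin m → ℝ} (i : Fin m) :
    ∀ᶠ u : ℂ × ℂ in 𝓝 0, GenSum (fun n => ((geom (a i) (b i) n : ℝ) : ℂ)) u
      (∏ l ∈ {i}, (1 - a l * u.1 - b l * u.2))⁻¹ := by
  filter_upwards [eventually_norm_add_norm_lt_one (a i : ℂ) (b i)] with u hu
  simp only [Finset.prod_singleton, ofReal_geom]
  exact genSum_geom hu

/-- Transfer with T = {i}: rescaling by the critical point turns a_i, b_i into p/(p+q), q/(p+q), the
weights of the local limit theorem. -/
theorem smooth_asymptotics {a b : Fin m → ℝ} (ha : ∀ i, 0 < a i) (hb : ∀ i, 0 < b i)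
    {P : MvPolynomial (Fin 2) ℂ} {f : ℕ → ℕ → ℂ} (hf : IsTaylorCoeff P (denom a b) f) (i : Fin m)
    {p q : ℕ} (hp : 0 < p) (hq : 0 < q)
    (hQ : ∀ l, l ≠ i → 0 < realFactor a b l (critPt a b i (p, q)))
    (hP : evalAtReal P (critPt a b i (p, q)) ≠ 0) :
    smoothConst a b i p q ≠ 0 ∧
    DiagonalAsymptotics f P p q (fun k => smoothConst a b i p q / √k) (critPt a b i (p, q)) := by
  have hp' : (0 : ℝ) < p := by exact_mod_cast hp
  have hq' : (0 : ℝ) < q := by exact_mod_cast hq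
  have hai := ha i
  have hbi := hb i
  have e1 : a i * (critPt a b i (p, q)).1 = p / (p + q) := by
    simp only [critPt]
    field_simp
  have e2 : b i * (critPt a b i (p, q)).2 = q / (p + q) := by
    simp only [critPt]
    field_simp
  have hv1 : 0 < (critPt a b i (p, q)).1 := by
    simp only [critPt]
    positivity
  have hv2 : 0 < (critPt a b i (p, q)).2 := by
    simp only [critPt]
    positivity
  obtain ⟨C, hC, hbound⟩ := exists_sqrt_mul_geom_le hp hq
  have hprod : 0 < ∏ l ∈ {i}ᶜ, realFactor a b l (critPt a b i (p, q)) :=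
    Finset.prod_pos fun l hl => hQ l (by simpa using hl)
  have hconst : smoothConst a b i p q ≠ 0 := by
    have := localConst_pos hp hq
    unfold smoothConst
    positivity
  refine ⟨hconst, diagonalAsymptotics_of_tendsto hv1.ne' hv2.ne' ?_ hconst hP ?_⟩
  · filter_upwards [eventually_gt_atTop 0] with k hk
    have : (0 : ℝ) < k := by exact_mod_cast hk
    positivity
  · have key := tendsto_of_isTaylorCoeff ha hb hf {i} (eventually_genSum_geom_singleton i) hv1 hv2
      (H := geom ((p : ℝ) / (p + q)) (q / (p + q)))
      (fun n => by rw [geom_mul_monom, e1, e2]) (fun l hl => hQ l (by simpa using hl)) hp hq hC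
      (N := fun k => √k) (fun s t => tendsto_sqrt_mul_geom_shift hp hq s t)
      (fun k s t hs ht => by
        rw [abs_of_nonneg (mul_nonneg (Real.sqrt_nonneg _)
          (geom_nonneg (by positivity) (by positivity) _))]
        exact hbound k s t hs ht)
    convert! key using 2
    have z1 : ((critPt a b i (p, q)).1 : ℂ) ≠ 0 := by exact_mod_cast hv1.ne'
    have z2 : ((critPt a b i (p, q)).2 : ℂ) ≠ 0 := by exact_mod_cast hv2.ne'
    rw [div_eq_iff (mul_ne_zero z1 z2)]
    simp only [smoothConst, realFactor]
    push_cast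
    ring

/-- Transfer with T = {i, j} and no normalization: at the vertex both pairs of rescaled weights sum
to 1, and Δ_ij ≠ 0 keeps them distinct. -/
theorem corner_asymptotics {a b : Fin m → ℝ} (ha : ∀ i, 0 < a i) (hb : ∀ i, 0 < b i)
    {P : MvPolynomial (Fin 2) ℂ} {f : ℕ → ℕ → ℂ} (hf : IsTaylorCoeff P (denom a b) f) {i j : Fin m}
    (hij : i ≠ j) (hΔ : delta a b i j ≠ 0) {p q : ℕ} (hp : 0 < p) (hq : 0 < q)
    (hv1 : 0 < (interPt a b i j).1) (hv2 : 0 < (interPt a b i j).2)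
    (hQ : ∀ l, l ≠ i → l ≠ j → 0 < realFactor a b l (interPt a b i j))
    (hP : evalAtReal P (interPt a b i j) ≠ 0)
    (hsign : (p * (b i * (interPt a b i j).2) - q * (a i * (interPt a b i j).1)) *
      (p * (b j * (interPt a b i j).2) - q * (a j * (interPt a b i j).1)) < 0) :
    cornerConst a b i j ≠ 0 ∧
    DiagonalAsymptotics f P p q (fun _ => cornerConst a b i j) (interPt a b i j) := by
  obtain ⟨h1, h2⟩ := (eq_interPt_iff hΔ (interPt a b i j)).1 rfl
  set v := interPt a b i j with hv
  have s1 : a i * v.1 + b i * v.2 = 1 := by linarith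
  have s2 : a j * v.1 + b j * v.2 = 1 := by linarith
  have p1 := mul_pos (ha i) hv1
  have p2 := mul_pos (hb i) hv2
  have p3 := mul_pos (ha j) hv1
  have p4 := mul_pos (hb j) hv2
  have hne : b i * v.2 ≠ b j * v.2 := by
    intro h
    have h' : a i * v.1 = a j * v.1 := by linarith
    exact hΔ (by rw [delta, mul_right_cancel₀ hv1.ne' h', mul_right_cancel₀ hv2.ne' h, sub_self])
  have hprod : 0 < ∏ l ∈ {i, j}ᶜ, realFactor a b l v :=
    Finset.prod_pos fun l hl => by
      simp only [Finset.mem_compl, Finset.mem_insert, Finset.mem_singleton, not_or] at hl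
      exact hQ l hl.1 hl.2
  have hconst : cornerConst a b i j ≠ 0 := by
    have := abs_pos.2 (sub_ne_zero.2 hne)
    unfold cornerConst
    positivity
  refine ⟨hconst, ?_⟩
  have hh : ∀ᶠ u : ℂ × ℂ in 𝓝 0,
      GenSum (fun n => ((conv (geom (a i) (b i)) (geom (a j) (b j)) n : ℝ) : ℂ)) u
        (∏ l ∈ {i, j}, (1 - a l * u.1 - b l * u.2))⁻¹ := by
    filter_upwards [eventually_norm_add_norm_lt_one (a i : ℂ) (b i),
      eventually_norm_add_norm_lt_one (a j : ℂ) (b j)] with u hu hu'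
    simp only [ofReal_conv, ofReal_geom, Finset.prod_pair hij, mul_inv]
    exact (genSum_geom hu).mul_conv (genSum_geom hu')
  have key := tendsto_of_isTaylorCoeff ha hb hf {i, j} hh hv1 hv2
    (H := conv (geom (a i * v.1) (b i * v.2)) (geom (a j * v.1) (b j * v.2)))
    (fun n => by simp only [conv_mul_monom, geom_mul_monom])
    (fun l hl => by
      simp only [Finset.mem_insert, Finset.mem_singleton, not_or] at hl
      exact hQ l hl.1 hl.2) hp hq (C := |b i * v.2 - b j * v.2|⁻¹) (by positivity)
    (N := fun _ => 1)
    (fun s t => by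
      simpa only [one_mul] using tendsto_conv_geom p1 p2 p3 p4 s1 s2 hp hq hsign s t)
    (fun k s t _ _ => by
      rw [one_mul]
      refine (conv_geom_le p1.le p2.le p3.le p4.le s1 s2 hne _).trans ?_
      exact le_mul_of_one_le_right (by positivity) (le_add_of_nonneg_left (by positivity)))
  have := diagonalAsymptotics_of_tendsto (f := f) (P := P) (p := p) (q := q) hv1.ne' hv2.ne'
    (N := fun _ => 1) (Eventually.of_forall fun _ => one_ne_zero) hconst hP (by
      convert! key using 2
      have z1 : (v.1 : ℂ) ≠ 0 := by exact_mod_cast hv1.ne'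
      have z2 : (v.2 : ℂ) ≠ 0 := by exact_mod_cast hv2.ne'
      rw [div_eq_iff (mul_ne_zero z1 z2)]
      simp only [cornerConst, realFactor, ← hv]
      push_cast
      ring)
  simpa only [div_one] using this

end Asymptotics

/-! ### Maxima of monomials over the polygon and the cones of directions. -/

section Geometry

variable {m : ℕ}

theorem mono_nonneg {d v : ℝ × ℝ} (h1 : 0 ≤ v.1) (h2 : 0 ≤ v.2) : 0 ≤ mono d v :=
  mul_nonneg (Real.rpow_nonneg h1 _) (Real.rpow_nonneg h2 _)

theorem mono_add {d e v : ℝ × ℝ} (h1 : 0 ≤ v.1) (h2 : 0 ≤ v.2) (hd1 : 0 ≤ d.1) (hd2 : 0 ≤ d.2)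
    (he1 : 0 ≤ e.1) (he2 : 0 ≤ e.2) : mono (d + e) v = mono d v * mono e v := by
  simp only [mono, Prod.fst_add, Prod.snd_add]
  rw [Real.rpow_add_of_nonneg h1 hd1 he1, Real.rpow_add_of_nonneg h2 hd2 he2]
  ring

theorem mono_natCast (p q : ℕ) (v : ℝ × ℝ) : mono ((p : ℝ), (q : ℝ)) v = v.1 ^ p * v.2 ^ q := by
  simp only [mono, Real.rpow_natCast]

/-- Weighted AM-GM: on the triangle below a line, a monomial whose exponents are proportional to
`(a z, b w)` is largest at the point `(z, w)` of the line. -/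
theorem mono_le_mono_of_line {a b : ℝ} (ha : 0 < a) (hb : 0 < b) {u v : ℝ × ℝ} (hv1 : 0 < v.1)
    (hv2 : 0 < v.2) (hv : a * v.1 + b * v.2 = 1) (hu1 : 0 ≤ u.1) (hu2 : 0 ≤ u.2)
    (hu : a * u.1 + b * u.2 ≤ 1) {s : ℝ} (hs : 0 ≤ s) :
    mono (s • (a * v.1, b * v.2)) u ≤ mono (s • (a * v.1, b * v.2)) v := by
  have hx : 0 ≤ u.1 / v.1 := by positivity
  have hy : 0 ≤ u.2 / v.2 := by positivity
  have hα : 0 ≤ a * v.1 := by positivity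
  have hβ : 0 ≤ b * v.2 := by positivity
  have amgm := Real.geom_mean_le_arith_mean2_weighted hα hβ hx hy hv
  have hle : (u.1 / v.1) ^ (a * v.1) * (u.2 / v.2) ^ (b * v.2) ≤ 1 := by
    refine amgm.trans (le_trans (le_of_eq ?_) hu)
    field_simp
  have hpow := Real.rpow_le_one (by positivity) hle hs
  rw [Real.mul_rpow (by positivity) (by positivity), ← Real.rpow_mul hx, ← Real.rpow_mul hy,
    mul_comm _ s, mul_comm _ s, Real.div_rpow hu1 hv1.le, Real.div_rpow hu2 hv2.le,
    div_mul_div_comm, div_le_one (by positivity)] at hpow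
  exact hpow

theorem continuous_realFactor (a b : Fin m → ℝ) (i : Fin m) : Continuous (realFactor a b i) := by
  unfold realFactor
  fun_prop

/-- The slope of `z ^ p * w ^ q` along the line `Q_i = 0`, for `d = (p, q)`, up to a positive
factor. -/
def slope (a b : Fin m → ℝ) (i : Fin m) (d v : ℝ × ℝ) : ℝ := d.1 * (b i * v.2) - d.2 * (a i * v.1)

/-- Zero slope is the Lagrange condition. It confines d to the line through (a_i z, b_i w), so each
point of Q_i = 0 to be avoided excludes only one line of directions. -/
theorem eq_smul_of_slope_eq_zero {a b : Fin m → ℝ} {i : Fin m} {d v : ℝ × ℝ}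
    (hv : realFactor a b i v = 0) (h : slope a b i d v = 0) :
    d = (d.1 + d.2) • (a i * v.1, b i * v.2) := by
  simp only [realFactor, slope] at hv h
  refine Prod.ext ?_ ?_
  · simp only [Prod.smul_mk, smul_eq_mul]
    linear_combination d.1 * hv + h
  · simp only [Prod.smul_mk, smul_eq_mul]
    linear_combination d.2 * hv - h

/-- Only the lines through v can obstruct a small move, and the hypothesis makes Q_l increase along
it for each of them. -/
theorem eventually_mem_polygon {a b : Fin m → ℝ} {v : ℝ × ℝ} (hv : v ∈ polygon a b)
    (hv1 : 0 < v.1) (hv2 : 0 < v.2) {c d : ℝ}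
    (h : ∀ l, realFactor a b l v = 0 → c * (a l * v.1) + d * (b l * v.2) < 0) :
    ∀ᶠ ε : ℝ in 𝓝[>] 0, (v.1 * (1 + c * ε), v.2 * (1 + d * ε)) ∈ polygon a b := by
  have hc1 : Continuous fun ε : ℝ => v.1 * (1 + c * ε) := by fun_prop
  have hc2 : Continuous fun ε : ℝ => v.2 * (1 + d * ε) := by fun_prop
  have h1 : ∀ᶠ ε : ℝ in 𝓝[>] 0, 0 < v.1 * (1 + c * ε) :=
    ((hc1.tendsto 0).eventually (lt_mem_nhds (by simpa using hv1))).filter_mono nhdsWithin_le_nhds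
  have h2 : ∀ᶠ ε : ℝ in 𝓝[>] 0, 0 < v.2 * (1 + d * ε) :=
    ((hc2.tendsto 0).eventually (lt_mem_nhds (by simpa using hv2))).filter_mono nhdsWithin_le_nhds
  have h3 : ∀ᶠ ε : ℝ in 𝓝[>] 0, ∀ l,
      0 ≤ realFactor a b l (v.1 * (1 + c * ε), v.2 * (1 + d * ε)) := by
    refine eventually_all.2 fun l => ?_
    rcases (((mem_polygon_iff v).1 hv).2.2 l).eq_or_lt with h0 | h0
    · filter_upwards [eventually_mem_nhdsWithin] with ε hε
      have := mul_pos (neg_pos.2 (h l h0.symm)) hε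
      simp only [realFactor]
      linarith
    · have hc3 := (continuous_realFactor a b l).comp (hc1.prodMk hc2)
      refine Eventually.filter_mono nhdsWithin_le_nhds (((hc3.tendsto 0).eventually
        (lt_mem_nhds ?_)).mono fun _ => le_of_lt)
      simpa [realFactor] using h0
  filter_upwards [h1, h2, h3] with ε e1 e2 e3
  exact (mem_polygon_iff _).2 ⟨e1.le, e2.le, e3⟩

/-- Replace (z, w) by (z(1 + cε), w(1 - ε)). Positive slopes leave room for c slightly above q/p, so
that the move stays in M while the monomial grows. -/
theorem not_isMaxOn_of_slope_pos {a b : Fin m → ℝ} {v : ℝ × ℝ}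
    (hv : v ∈ polygon a b) (hv1 : 0 < v.1) (hv2 : 0 < v.2) {p q : ℕ} (hp : 0 < p) (hq : 0 < q)
    (h : ∀ l, realFactor a b l v = 0 → 0 < slope a b l ((p : ℝ), (q : ℝ)) v) :
    ¬ IsMaxOn (mono ((p : ℝ), (q : ℝ))) (polygon a b) v := by
  have hp' : (0 : ℝ) < p := by exact_mod_cast hp
  have hq' : (0 : ℝ) < q := by exact_mod_cast hq
  obtain ⟨c, hc, hqc⟩ : ∃ c : ℝ, (∀ l, realFactor a b l v = 0 → c * (a l * v.1) < b l * v.2) ∧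
      (q : ℝ) / p < c := by
    refine Eventually.exists (f := 𝓝[>] ((q : ℝ) / p))
      (Eventually.and (eventually_all.2 fun l => ?_) eventually_mem_nhdsWithin)
    by_cases hl : realFactor a b l v = 0
    · have hcont : Continuous fun c : ℝ => c * (a l * v.1) := by fun_prop
      refine (((hcont.tendsto (q / p)).eventually (gt_mem_nhds ?_)).filter_mono
        nhdsWithin_le_nhds).mono fun _ h _ => h
      have := h l hl
      simp only [slope] at this
      rw [div_mul_eq_mul_div, div_lt_iff₀ hp']
      linarith
    · exact Eventually.of_forall fun _ h => absurd h hl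
  have hc0 : 0 < c := lt_trans (by positivity) hqc
  rw [div_lt_iff₀ hp', mul_comm] at hqc
  obtain ⟨ε, hε, hmem⟩ := ((eventually_one_lt_pow_mul_pow hc0 hqc).and
    (eventually_mem_polygon hv hv1 hv2 (c := c) (d := -1) fun l hl => by
      linarith [hc l hl])).exists
  intro hmax
  have hle := hmax hmem
  simp only [Set.mem_ofPred_eq, mono_natCast] at hle
  have hpos : 0 < v.1 ^ p * v.2 ^ q := by positivity
  rw [neg_one_mul, ← sub_eq_add_neg, mul_pow, mul_pow, mul_mul_mul_comm,
    mul_comm ((1 + c * ε) ^ p)] at hle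
  exact absurd hle (not_le.2 (lt_mul_of_one_lt_right hpos hε))

theorem not_isMaxOn_of_slope_neg {a b : Fin m → ℝ} {v : ℝ × ℝ}
    (hv : v ∈ polygon a b) (hv1 : 0 < v.1) (hv2 : 0 < v.2) {p q : ℕ} (hp : 0 < p) (hq : 0 < q)
    (h : ∀ l, realFactor a b l v = 0 → slope a b l ((p : ℝ), (q : ℝ)) v < 0) :
    ¬ IsMaxOn (mono ((p : ℝ), (q : ℝ))) (polygon a b) v := by
  have hmem_iff : ∀ u : ℝ × ℝ, u.swap ∈ polygon b a ↔ u ∈ polygon a b := fun u => by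
    simp only [mem_polygon_iff, Prod.fst_swap, Prod.snd_swap, sub_right_comm 1 (b _ * _)]
    tauto
  have hmono : ∀ u : ℝ × ℝ, mono ((q : ℝ), (p : ℝ)) u.swap = mono ((p : ℝ), (q : ℝ)) u :=
    fun u => mul_comm _ _
  intro hmax
  refine not_isMaxOn_of_slope_pos ((hmem_iff v).2 hv) hv2 hv1 hq hp (fun l hl => ?_)
    fun u hu => ?_
  · have := h l (by rwa [realFactor, sub_right_comm])
    simp only [slope, Prod.fst_swap, Prod.snd_swap] at this ⊢
    linarith
  · have := hmax ((hmem_iff u.swap).1 (by rwa [Prod.swap_swap]))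
    simp only [Set.mem_ofPred_eq] at this ⊢
    rwa [← hmono, Prod.swap_swap, ← hmono v] at this

theorem exists_maxAttainedAt (hm : 1 ≤ m) {a b : Fin m → ℝ} (ha : ∀ i, 0 < a i)
    (hb : ∀ i, 0 < b i) (p q : ℕ) : ∃ v, MaxAttainedAt (mono ((p : ℝ), (q : ℝ))) (polygon a b) v := by
  have hsub : polygon a b ⊆ Set.Icc (0, 0) (1 / a ⟨0, hm⟩, 1 / b ⟨0, hm⟩) := by
    intro v hv
    obtain ⟨h1, h2, h3⟩ := (mem_polygon_iff v).1 hv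
    have h := h3 ⟨0, hm⟩
    have e1 := mul_nonneg (ha ⟨0, hm⟩).le h1
    have e2 := mul_nonneg (hb ⟨0, hm⟩).le h2
    refine ⟨⟨h1, h2⟩, ?_, ?_⟩
    · rw [le_div_iff₀ (ha _)]
      linarith
    · rw [le_div_iff₀ (hb _)]
      linarith
  have hcomp : IsCompact (polygon a b) := isCompact_Icc.of_isClosed_subset isClosed_closure hsub
  have hcont : Continuous (mono ((p : ℝ), (q : ℝ))) := by
    have : mono ((p : ℝ), (q : ℝ)) = fun v => v.1 ^ p * v.2 ^ q := funext (mono_natCast p q)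
    rw [this]
    fun_prop
  exact hcomp.exists_isMaxOn ⟨(0, 0), (mem_polygon_iff _).2 (by simp)⟩ hcont.continuousOn

theorem exists_pos_mem_polygon (a b : Fin m → ℝ) :
    ∃ s : ℝ, 0 < s ∧ (s, s) ∈ polygon a b := by
  have hev : ∀ᶠ s : ℝ in 𝓝[>] 0, ∀ i, 0 < 1 - a i * s - b i * s := by
    refine eventually_all.2 fun i => ?_
    have hcont : Continuous fun s : ℝ => 1 - a i * s - b i * s := by fun_prop
    exact ((hcont.tendsto 0).eventually (lt_mem_nhds (by simp))).filter_mono nhdsWithin_le_nhds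
  obtain ⟨s, hs, hs0⟩ := (hev.and eventually_mem_nhdsWithin).exists
  have hs0' : 0 < s := hs0
  exact ⟨s, hs0', (mem_polygon_iff _).2 ⟨hs0'.le, hs0'.le, fun i => (hs i).le⟩⟩

theorem MaxAttainedAt.pos {a b : Fin m → ℝ} {p q : ℕ} (hp : 0 < p) (hq : 0 < q) {v : ℝ × ℝ}
    (h : MaxAttainedAt (mono ((p : ℝ), (q : ℝ))) (polygon a b) v) : 0 < v.1 ∧ 0 < v.2 := by
  obtain ⟨s, hs, hmem⟩ := exists_pos_mem_polygon a b
  have hle := h.2 hmem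
  simp only [Set.mem_ofPred_eq, mono_natCast] at hle
  have hpos : 0 < v.1 ^ p * v.2 ^ q := lt_of_lt_of_le (by positivity) hle
  obtain ⟨h1, h2, -⟩ := (mem_polygon_iff v).1 h.1
  refine ⟨h1.lt_of_ne fun h0 => ?_, h2.lt_of_ne fun h0 => ?_⟩
  · rw [← h0, zero_pow hp.ne', zero_mul] at hpos
    exact hpos.false
  · rw [← h0, zero_pow hq.ne', mul_zero] at hpos
    exact hpos.false

theorem realFactor_critPt {a b : Fin m → ℝ} {i : Fin m} (ha : 0 < a i) (hb : 0 < b i) {d : ℝ × ℝ}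
    (hd : 0 < d.1 + d.2) : realFactor a b i (critPt a b i d) = 0 :=
  ((eq_critPt_iff ha hb hd _).1 rfl).1

theorem slope_critPt {a b : Fin m → ℝ} {i : Fin m} (ha : 0 < a i) (hb : 0 < b i) {d : ℝ × ℝ}
    (hd : 0 < d.1 + d.2) : slope a b i d (critPt a b i d) = 0 := by
  have := ((eq_critPt_iff ha hb hd _).1 rfl).2
  simp only [slope]
  linarith

/-- The hypotheses persist for nearby directions, and AM-GM on the whole triangle below Q_i = 0,
which contains M, gives both maxima. -/
theorem mem_interior_coneK {a b : Fin m → ℝ} (ha : ∀ i, 0 < a i) (hb : ∀ i, 0 < b i) {i : Fin m}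
    {d : ℝ × ℝ} (hd1 : 0 < d.1) (hd2 : 0 < d.2)
    (hQ : ∀ l, l ≠ i → 0 < realFactor a b l (critPt a b i d)) : d ∈ interior (coneK a b i) := by
  have hai := ha i
  have hbi := hb i
  have hcrit : ContinuousAt (critPt a b i) d := by
    unfold critPt
    have : a i * (d.1 + d.2) ≠ 0 := by positivity
    have : b i * (d.1 + d.2) ≠ 0 := by positivity
    fun_prop (disch := assumption)
  have hev : ∀ᶠ e : ℝ × ℝ in 𝓝 d, 0 < e.1 ∧ 0 < e.2 ∧
      ∀ l, l ≠ i → 0 < realFactor a b l (critPt a b i e) := by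
    refine (continuousAt_fst.eventually (lt_mem_nhds hd1)).and
      ((continuousAt_snd.eventually (lt_mem_nhds hd2)).and (eventually_all.2 fun l => ?_))
    by_cases hl : l = i
    · exact Eventually.of_forall fun _ h => absurd hl h
    · exact (((continuous_realFactor a b l).continuousAt.comp hcrit).eventually
        (lt_mem_nhds (hQ l hl))).mono fun _ h _ => h
  rw [mem_interior_iff_mem_nhds]
  filter_upwards [hev] with e ⟨he1, he2, he⟩
  have hS : 0 < e.1 + e.2 := by positivity
  have hz := realFactor_critPt hai hbi hS
  have hv1 : 0 < (critPt a b i e).1 := by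
    simp only [critPt]
    positivity
  have hv2 : 0 < (critPt a b i e).2 := by
    simp only [critPt]
    positivity
  have hmax : ∀ u : ℝ × ℝ, 0 ≤ u.1 → 0 ≤ u.2 → 0 ≤ 1 - a i * u.1 - b i * u.2 →
      mono e u ≤ mono e (critPt a b i e) := by
    intro u h1 h2 h3
    have hz' : 1 - a i * (critPt a b i e).1 - b i * (critPt a b i e).2 = 0 := hz
    have := mono_le_mono_of_line hai hbi hv1 hv2 (by linarith) h1 h2 (by linarith) hS.le
    rwa [← eq_smul_of_slope_eq_zero hz (slope_critPt hai hbi hS)] at this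
  refine ⟨he1.le, he2.le, ⟨(mem_polygon_iff _).2 ⟨hv1.le, hv2.le, fun l => ?_⟩, ?_⟩,
    ⟨⟨hv1.le, hv2.le, hz⟩, ?_⟩⟩
  · rcases eq_or_ne l i with rfl | hl
    · exact hz.ge
    · exact (he l hl).le
  · intro u hu
    obtain ⟨h1, h2, h3⟩ := (mem_polygon_iff u).1 hu
    exact hmax u h1 h2 (h3 i)
  · rintro u ⟨h1, h2, h3⟩
    exact hmax u h1 h2 h3.ge

/-- Strict slope signs are an open condition on the direction. They make it a positive combination
of (a_i z, b_i w) and (a_j z, b_j w), so the monomial is a product of two, each maximal at the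
vertex by AM-GM. -/
theorem mem_interior_coneOmega {a b : Fin m → ℝ} (ha : ∀ i, 0 < a i) (hb : ∀ i, 0 < b i)
    {i j : Fin m} (hΔ : delta a b i j ≠ 0) {d : ℝ × ℝ} (hd1 : 0 < d.1) (hd2 : 0 < d.2)
    (hv : interPt a b i j ∈ polygon a b) (hv1 : 0 < (interPt a b i j).1)
    (hv2 : 0 < (interPt a b i j).2) (hi : slope a b i d (interPt a b i j) < 0)
    (hj : 0 < slope a b j d (interPt a b i j)) : d ∈ interior (coneOmega a b i j) := by
  obtain ⟨hz1, hz2⟩ := (eq_interPt_iff hΔ _).1 rfl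
  set v := interPt a b i j with hvdef
  have hcs : ∀ l, Continuous fun e => slope a b l e v := fun l => by
    unfold slope
    fun_prop
  have hev : ∀ᶠ e : ℝ × ℝ in 𝓝 d, 0 < e.1 ∧ 0 < e.2 ∧ slope a b i e v < 0 ∧ 0 < slope a b j e v :=
    (continuousAt_fst.eventually (lt_mem_nhds hd1)).and
      ((continuousAt_snd.eventually (lt_mem_nhds hd2)).and
        (((hcs i).continuousAt.eventually (gt_mem_nhds hi)).and
          ((hcs j).continuousAt.eventually (lt_mem_nhds hj))))
  rw [mem_interior_iff_mem_nhds]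
  filter_upwards [hev] with e ⟨he1, he2, hei, hej⟩
  refine ⟨he1.le, he2.le, hv, fun u hu => ?_⟩
  obtain ⟨h1, h2, h3⟩ := (mem_polygon_iff u).1 hu
  have p1 := mul_pos (ha i) hv1
  have p2 := mul_pos (hb i) hv2
  have p3 := mul_pos (ha j) hv1
  have p4 := mul_pos (hb j) hv2
  have hD : 0 < b j * v.2 - b i * v.2 := by
    simp only [slope] at hei hej
    have : 0 < (b j * v.2 - b i * v.2) * (e.1 + e.2) := by
      have e1 : a i * v.1 = 1 - b i * v.2 := by linarith
      have e2 : a j * v.1 = 1 - b j * v.2 := by linarith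
      rw [e1] at hei
      rw [e2] at hej
      linarith
    exact pos_of_mul_pos_left this (by positivity)
  set D := b j * v.2 - b i * v.2 with hDdef
  -- Cramer's rule: as both vectors have coordinate sum 1, their determinant is `D`.
  have hdec : e = (slope a b j e v / D) • (a i * v.1, b i * v.2)
      + (-slope a b i e v / D) • (a j * v.1, b j * v.2) := by
    refine Prod.ext ?_ ?_
    · simp only [Prod.fst_add, Prod.smul_mk, smul_eq_mul]
      field_simp
      simp only [slope, hDdef]
      linear_combination (e.1 * b j * v.2) * hz1 - (e.1 * b i * v.2) * hz2
    · simp only [Prod.snd_add, Prod.smul_mk, smul_eq_mul]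
      field_simp
      simp only [slope, hDdef]
      linear_combination (e.2 * b j * v.2) * hz1 - (e.2 * b i * v.2) * hz2
  have hs : 0 ≤ slope a b j e v / D := by positivity
  have ht : 0 ≤ -slope a b i e v / D := div_nonneg (by linarith) hD.le
  have m1 := mono_le_mono_of_line (ha i) (hb i) hv1 hv2 (by linarith) h1 h2
    (by linarith [h3 i]) hs
  have m2 := mono_le_mono_of_line (ha j) (hb j) hv1 hv2 (by linarith) h1 h2
    (by linarith [h3 j]) ht
  simp only [Set.mem_ofPred_eq]
  rw [hdec, mono_add h1 h2, mono_add hv1.le hv2.le]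
  · exact mul_le_mul m1 m2 (mono_nonneg h1 h2) (mono_nonneg hv1.le hv2.le)
  all_goals
    simp only [Prod.smul_mk, smul_eq_mul]
    positivity

/-- Q_i and Q_j are nonnegative on M, so on a segment of M with this point inside they vanish at the
ends too. Needed to apply the nonvanishing of P at vertices. -/
theorem interPt_mem_extremePoints {a b : Fin m → ℝ} {i j : Fin m} (hΔ : delta a b i j ≠ 0)
    (hv : interPt a b i j ∈ polygon a b) :
    interPt a b i j ∈ Set.extremePoints ℝ (polygon a b) := by
  obtain ⟨hz1, hz2⟩ := (eq_interPt_iff hΔ _).1 rfl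
  refine ⟨hv, fun x hx y hy hxy => ?_⟩
  obtain ⟨s, t, hs, ht, hst, he⟩ := hxy
  have e1 : (interPt a b i j).1 = s * x.1 + t * y.1 := by rw [← he]; rfl
  have e2 : (interPt a b i j).2 = s * x.2 + t * y.2 := by rw [← he]; rfl
  have key : ∀ l, 1 - a l * (interPt a b i j).1 - b l * (interPt a b i j).2 = 0 →
      1 - a l * x.1 - b l * x.2 = 0 := by
    intro l hl
    have hxl := ((mem_polygon_iff x).1 hx).2.2 l
    have hyl := ((mem_polygon_iff y).1 hy).2.2 l
    rw [e1, e2] at hl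
    have h0 : s * (1 - a l * x.1 - b l * x.2) + t * (1 - a l * y.1 - b l * y.2) = 0 := by
      linear_combination hl + hst
    have := mul_nonneg hs.le hxl
    have := mul_nonneg ht.le hyl
    exact (mul_eq_zero.1 (show s * (1 - a l * x.1 - b l * x.2) = 0 by linarith)).resolve_left hs.ne'
  exact (eq_interPt_iff hΔ x).2 ⟨key i hz1, key j hz2⟩

theorem GeneralPosition.realFactor_interPt_ne_zero {a b : Fin m → ℝ} (hgen : GeneralPosition a b)
    {i j l : Fin m} (hij : i ≠ j) (hli : l ≠ i) (hlj : l ≠ j) :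
    realFactor a b l (interPt a b i j) ≠ 0 := by
  intro h
  obtain ⟨h1, h2⟩ := (eq_interPt_iff (hgen.pair i j hij) _).1 rfl
  refine hgen.triple i j l hij hlj.symm hli.symm
    ⟨((interPt a b i j).1 : ℂ), ((interPt a b i j).2 : ℂ), ?_, ?_, ?_⟩ <;>
  rw [evalAt_linFactor]
  · exact_mod_cast h1
  · exact_mod_cast h2
  · exact_mod_cast h

theorem realFactor_pos_of_mem_coneK {a b : Fin m → ℝ} (ha : ∀ i, 0 < a i) (hb : ∀ i, 0 < b i)
    (hgen : GeneralPosition a b) {i : Fin m} {d : ℝ × ℝ} (hd : 0 < d.1 + d.2)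
    (hslope : ∀ j, i ≠ j → slope a b i d (interPt a b i j) ≠ 0) (h : d ∈ coneK a b i) :
    ∀ l, l ≠ i → 0 < realFactor a b l (critPt a b i d) := by
  intro l hl
  obtain ⟨-, -, ⟨hmem, -⟩, -⟩ := h
  refine (((mem_polygon_iff _).1 hmem).2.2 l).lt_of_ne fun h0 => ?_
  refine hslope l hl.symm ?_
  rw [← (eq_interPt_iff (hgen.pair i l hl.symm) (critPt a b i d)).2
    ⟨realFactor_critPt (ha i) (hb i) hd, h0.symm⟩]
  exact slope_critPt (ha i) (hb i) hd

/-- By general position only lines i and j are active, so two slopes of equal sign would allow an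
uphill move. -/
theorem slope_mul_slope_neg_of_maxAttainedAt {a b : Fin m → ℝ}
    (hgen : GeneralPosition a b) {i j : Fin m} (hij : i ≠ j) {p q : ℕ}
    (hp : 0 < p) (hq : 0 < q)
    (hi : slope a b i ((p : ℝ), (q : ℝ)) (interPt a b i j) ≠ 0)
    (hj : slope a b j ((p : ℝ), (q : ℝ)) (interPt a b i j) ≠ 0)
    (h : MaxAttainedAt (mono ((p : ℝ), (q : ℝ))) (polygon a b) (interPt a b i j)) :
    slope a b i ((p : ℝ), (q : ℝ)) (interPt a b i j) *
      slope a b j ((p : ℝ), (q : ℝ)) (interPt a b i j) < 0 := by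
  obtain ⟨hv1, hv2⟩ := h.pos hp hq
  have hact : ∀ l, realFactor a b l (interPt a b i j) = 0 → l = i ∨ l = j := by
    intro l hl
    by_contra! hne
    exact hgen.realFactor_interPt_ne_zero hij hne.1 hne.2 hl
  by_contra! hnonneg
  rcases mul_pos_iff.1 (hnonneg.lt_of_ne (mul_ne_zero hi hj).symm) with ⟨h1, h2⟩ | ⟨h1, h2⟩
  · refine not_isMaxOn_of_slope_pos h.1 hv1 hv2 hp hq (fun l hl => ?_) h.2
    rcases hact l hl with rfl | rfl <;> assumption
  · refine not_isMaxOn_of_slope_neg h.1 hv1 hv2 hp hq (fun l hl => ?_) h.2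
    rcases hact l hl with rfl | rfl <;> assumption

/-- A maximizer lies on a line with slope ≤ 0 and on one with slope ≥ 0. If these coincide it is a
critical point, otherwise a vertex; the excluded directions make the inequalities strict. -/
theorem mem_interior_cone (hm : 1 ≤ m) {a b : Fin m → ℝ} (ha : ∀ i, 0 < a i) (hb : ∀ i, 0 < b i)
    (hgen : GeneralPosition a b) {p q : ℕ} (hp : 0 < p) (hq : 0 < q)
    (hslope : ∀ i j, i ≠ j → slope a b i ((p : ℝ), (q : ℝ)) (interPt a b i j) ≠ 0 ∧
      slope a b j ((p : ℝ), (q : ℝ)) (interPt a b i j) ≠ 0) :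
    (∃ i, ((p : ℝ), (q : ℝ)) ∈ interior (coneK a b i)) ∨
      ∃ i j, i ≠ j ∧ ((p : ℝ), (q : ℝ)) ∈ interior (coneOmega a b i j) := by
  have hp' : (0 : ℝ) < p := by exact_mod_cast hp
  have hq' : (0 : ℝ) < q := by exact_mod_cast hq
  obtain ⟨v, hmax⟩ := exists_maxAttainedAt hm ha hb p q
  obtain ⟨hv1, hv2⟩ := hmax.pos hp hq
  obtain ⟨i, hi, hsi⟩ : ∃ i, realFactor a b i v = 0 ∧ slope a b i ((p : ℝ), (q : ℝ)) v ≤ 0 := by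
    by_contra! hne
    exact not_isMaxOn_of_slope_pos hmax.1 hv1 hv2 hp hq hne hmax.2
  obtain ⟨j, hj, hsj⟩ : ∃ j, realFactor a b j v = 0 ∧ 0 ≤ slope a b j ((p : ℝ), (q : ℝ)) v := by
    by_contra! hne
    exact not_isMaxOn_of_slope_neg hmax.1 hv1 hv2 hp hq hne hmax.2
  rcases eq_or_ne i j with rfl | hij
  · left
    have hv : v = critPt a b i ((p : ℝ), (q : ℝ)) := by
      refine (eq_critPt_iff (ha i) (hb i) (by positivity) v).2 ⟨hi, ?_⟩
      have := le_antisymm hsi hsj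
      simp only [slope] at this
      linarith
    refine ⟨i, mem_interior_coneK ha hb hp' hq' fun l hl => ?_⟩
    rw [← hv]
    refine (((mem_polygon_iff v).1 hmax.1).2.2 l).lt_of_ne fun h0 => ?_
    refine (hslope i l hl.symm).1 ?_
    rw [← (eq_interPt_iff (hgen.pair i l hl.symm) v).2 ⟨hi, h0.symm⟩]
    exact le_antisymm hsi hsj
  · right
    have hv := (eq_interPt_iff (hgen.pair i j hij) v).2 ⟨hi, hj⟩
    rw [hv] at hsi hsj hv1 hv2 hmax
    exact ⟨i, j, hij, mem_interior_coneOmega ha hb (hgen.pair i j hij) hp' hq' hmax.1 hv1 hv2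
      (hsi.lt_of_ne (hslope i j hij).1) (hsj.lt_of_ne (hslope i j hij).2.symm)⟩

/-- A polynomial without common factor with `Q` has finitely many real zeros on the line
`Q_i = 0`. -/
theorem finite_zeros_on_line {a b : Fin m → ℝ} (ha : ∀ i, 0 < a i) (hb : ∀ i, 0 < b i)
    {P : MvPolynomial (Fin 2) ℂ} (hP : IsRelPrime P (denom a b)) (i : Fin m) :
    {z : ℝ | evalAt P z ((1 - a i * z) / b i) = 0}.Finite := by
  have hai : (a i : ℂ) ≠ 0 := by exact_mod_cast (ha i).ne'
  have hbi : (b i : ℂ) ≠ 0 := by exact_mod_cast (hb i).ne'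
  -- Restriction to the line, parametrized by z.
  let φ : MvPolynomial (Fin 2) ℂ →ₐ[ℂ] Polynomial ℂ := MvPolynomial.aeval
    ![Polynomial.X, (1 - Polynomial.C (a i : ℂ) * Polynomial.X) * Polynomial.C (b i : ℂ)⁻¹]
  have hφ : ∀ z : ℂ, (φ P).eval z = evalAt P z ((1 - a i * z) / b i) := by
    intro z
    have : (Polynomial.evalRingHom z).comp φ.toRingHom
        = MvPolynomial.eval ![z, (1 - a i * z) / b i] := by
      refine MvPolynomial.ringHom_ext (fun r => ?_) fun k => ?_
      · simp [φ]
      · fin_cases k <;> simp [φ, div_eq_mul_inv]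
    exact congrArg (fun g : MvPolynomial (Fin 2) ℂ →+* ℂ => g P) this
  have hne : φ P ≠ 0 := by
    intro h0
    let ψ : Polynomial ℂ →ₐ[ℂ] MvPolynomial (Fin 2) ℂ := Polynomial.aeval (MvPolynomial.X 0)
    let π := Ideal.Quotient.mkₐ ℂ (Ideal.span {linFactor a b i})
    have hπ0 : π (linFactor a b i) = 0 :=
      Ideal.Quotient.eq_zero_iff_mem.2 (Ideal.mem_span_singleton_self _)
    -- Modulo Q_i every polynomial equals its restriction to the line, so a zero restriction means
    -- Q_i ∣ P.
    have hcomp : (π.comp ψ).comp φ = π := by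
      refine MvPolynomial.algHom_ext fun k => ?_
      fin_cases k
      · simp [φ, ψ]
      · have e : (1 - MvPolynomial.C (a i : ℂ) * MvPolynomial.X 0) * MvPolynomial.C (b i : ℂ)⁻¹
            = MvPolynomial.X (1 : Fin 2) + linFactor a b i * MvPolynomial.C (b i : ℂ)⁻¹ := by
          have hb1 : MvPolynomial.C (b i : ℂ) * MvPolynomial.C (b i : ℂ)⁻¹
              = (1 : MvPolynomial (Fin 2) ℂ) := by
            rw [← map_mul, mul_inv_cancel₀ hbi, map_one]
          rw [linFactor]
          linear_combination (MvPolynomial.X (1 : Fin 2)) * hb1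
        have e2 : ψ (φ (MvPolynomial.X 1))
            = (1 - MvPolynomial.C (a i : ℂ) * MvPolynomial.X 0) * MvPolynomial.C (b i : ℂ)⁻¹ := by
          simp [φ, ψ, MvPolynomial.algebraMap_eq]
        change π (ψ (φ (MvPolynomial.X 1))) = π (MvPolynomial.X 1)
        rw [e2, e, map_add, map_mul, hπ0, zero_mul, add_zero]
    have hπP : π P = 0 := by
      rw [← hcomp]
      change π (ψ (φ P)) = 0
      rw [h0, map_zero, map_zero]
    have hdvd : linFactor a b i ∣ P :=
      Ideal.mem_span_singleton.1 (Ideal.Quotient.eq_zero_iff_mem.1 hπP)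
    have hunit := hP hdvd (Finset.dvd_prod_of_mem _ (Finset.mem_univ i))
    -- Q_i is no unit because it vanishes at (1/a_i, 0).
    have := hunit.map (MvPolynomial.eval ![((a i : ℂ))⁻¹, 0])
    rw [show MvPolynomial.eval ![((a i : ℂ))⁻¹, 0] (linFactor a b i) = 0 from by
      rw [← evalAt, evalAt_linFactor, mul_inv_cancel₀ hai, mul_zero, sub_self, sub_zero]] at this
    exact not_isUnit_zero this
  refine Set.Finite.subset ((Polynomial.finite_setOfPred_isRoot hne).preimage
    Complex.ofReal_injective.injOn) fun z hz => ?_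
  change (φ P).eval (z : ℂ) = 0
  rw [hφ]
  exact hz

end Geometry

variable {m : ℕ}

/-- The exceptional directions: the axes, the directions for which a critical point is a vertex,
and those for which `P` vanishes at a critical point. -/
def exceptionalDirections (a b : Fin m → ℝ) (Z : Fin m → Finset ℝ) : Finset (ℝ × ℝ) :=
  {(1, 0), (0, 1)} ∪
    ((Finset.univ ×ˢ Finset.univ ×ˢ Finset.univ).image fun t : Fin m × Fin m × Fin m =>
      (a t.1 * (interPt a b t.2.1 t.2.2).1, b t.1 * (interPt a b t.2.1 t.2.2).2)) ∪
    Finset.univ.biUnion fun i => (Z i).image fun z => (a i * z, 1 - a i * z)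

end LinearPoles

end

/-! ### Assembly: constants, exceptional directions, and the two asymptotic regimes. -/

theorem mainTheorem1 (m : ℕ) (hm : 1 ≤ m) (a b : Fin m → ℝ)
    (ha : ∀ i, 0 < a i) (hb : ∀ i, 0 < b i)
    (hgen : LinearPoles.GeneralPosition a b) :
    ∃ (cK : Fin m → ℕ → ℕ → ℝ) (cΩ : Fin m → Fin m → ℝ),
      (∀ i p q, cK i p q ≠ 0) ∧ (∀ i j, cΩ i j ≠ 0) ∧
      ∀ (P : MvPolynomial (Fin 2) ℂ), IsRelPrime P (LinearPoles.denom a b) →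
        (∀ v ∈ Set.extremePoints ℝ (LinearPoles.polygon a b),
          v.1 ≠ 0 → v.2 ≠ 0 → LinearPoles.evalAtReal P v ≠ 0) →
        ∀ f : ℕ → ℕ → ℂ, LinearPoles.IsTaylorCoeff P (LinearPoles.denom a b) f →
          LinearPoles.ForAlmostAllDirections fun p q =>
            ((∃ i, ((p : ℝ), (q : ℝ)) ∈ interior (LinearPoles.coneK a b i)) ∨
              (∃ i j, i ≠ j ∧ ((p : ℝ), (q : ℝ)) ∈ interior (LinearPoles.coneOmega a b i j))) ∧
            (∀ i, ((p : ℝ), (q : ℝ)) ∈ interior (LinearPoles.coneK a b i) →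
              LinearPoles.DiagonalAsymptotics f P p q (fun k => cK i p q / Real.sqrt k)
                (LinearPoles.critPt a b i (p, q))) ∧
            (∀ i j, i ≠ j → ((p : ℝ), (q : ℝ)) ∈ interior (LinearPoles.coneOmega a b i j) →
              LinearPoles.DiagonalAsymptotics f P p q (fun _ => cΩ i j)
                (LinearPoles.interPt a b i j)) := by
  open LinearPoles in
  classical
  -- The value 1 is a filler for indices where the formula degenerates to 0, such as p = 0 or i = j;
  -- the asymptotics never use it.
  refine ⟨fun i p q => if smoothConst a b i p q = 0 then 1 else smoothConst a b i p q,
    fun i j => if cornerConst a b i j = 0 then 1 else cornerConst a b i j,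
    fun i p q => ?_, fun i j => ?_,
    fun P hP hvert f hf => ⟨exceptionalDirections a b fun i =>
      (finite_zeros_on_line ha hb hP i).toFinset, fun p q hE => ?_⟩⟩
  · dsimp only
    split_ifs with h
    exacts [one_ne_zero, h]
  · dsimp only
    split_ifs with h
    exacts [one_ne_zero, h]
  simp only [exceptionalDirections, Finset.mem_union, Finset.mem_insert, Finset.mem_singleton,
    Finset.mem_image, Finset.mem_biUnion, Finset.mem_univ, Finset.mem_product, true_and] at hE
  have hp : 0 < p := Nat.pos_of_ne_zero fun h0 =>
    hE (0, 1) (Or.inl (Or.inl (Or.inr rfl))) q (by simp [h0])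
  have hq : 0 < q := Nat.pos_of_ne_zero fun h0 =>
    hE (1, 0) (Or.inl (Or.inl (Or.inl rfl))) p (by simp [h0])
  have hp' : (0 : ℝ) < p := by exact_mod_cast hp
  have hq' : (0 : ℝ) < q := by exact_mod_cast hq
  have hS : 0 < ((p : ℝ), (q : ℝ)).1 + ((p : ℝ), (q : ℝ)).2 := by positivity
  have hslope : ∀ i j, i ≠ j → slope a b i ((p : ℝ), (q : ℝ)) (interPt a b i j) ≠ 0 ∧
      slope a b j ((p : ℝ), (q : ℝ)) (interPt a b i j) ≠ 0 := by
    intro i j hij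
    obtain ⟨h1, h2⟩ := (eq_interPt_iff (hgen.pair i j hij) _).1 rfl
    exact ⟨fun h0 => hE _ (Or.inl (Or.inr ⟨(i, i, j), rfl⟩)) _
        (eq_smul_of_slope_eq_zero h1 h0),
      fun h0 => hE _ (Or.inl (Or.inr ⟨(j, i, j), rfl⟩)) _
        (eq_smul_of_slope_eq_zero h2 h0)⟩
  refine ⟨mem_interior_cone hm ha hb hgen hp hq hslope, fun i hi => ?_, fun i j hij hd => ?_⟩
  · have hz : realFactor a b i (critPt a b i (p, q)) = 0 := realFactor_critPt (ha i) (hb i) hS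
    have hPne : evalAtReal P (critPt a b i (p, q)) ≠ 0 := by
      intro h0
      have hw : (1 - a i * (critPt a b i (p, q)).1) / b i = (critPt a b i (p, q)).2 := by
        rw [div_eq_iff (hb i).ne']
        simp only [realFactor] at hz
        linarith
      have hw' : (1 - (a i : ℂ) * ((critPt a b i (p, q)).1 : ℂ)) / b i
          = ((critPt a b i (p, q)).2 : ℂ) := by exact_mod_cast hw
      -- If P vanished at the critical point, (p, q) would be p + q times the exceptional direction
      -- (a_i z, 1 - a_i z) of that zero.
      refine hE _ (Or.inr ⟨i, (critPt a b i (p, q)).1, ?_, rfl⟩) (p + q) ?_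
      · rw [Set.Finite.mem_toFinset, Set.mem_ofPred_eq, hw']
        exact h0
      · have := eq_smul_of_slope_eq_zero hz (slope_critPt (ha i) (hb i) hS)
        rwa [show b i * (critPt a b i (p, q)).2 = 1 - a i * (critPt a b i (p, q)).1 by
          simp only [realFactor] at hz
          linarith] at this
    obtain ⟨hc, has⟩ := smooth_asymptotics ha hb hf i hp hq
      (realFactor_pos_of_mem_coneK ha hb hgen hS (fun j hij => (hslope i j hij).1)
        (interior_subset hi)) hPne
    simpa only [if_neg hc] using has
  · obtain ⟨-, -, hmax⟩ := interior_subset hd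
    obtain ⟨hv1, hv2⟩ := hmax.pos hp hq
    obtain ⟨hc, has⟩ := corner_asymptotics ha hb hf hij (hgen.pair i j hij) hp hq hv1 hv2
      (fun l hli hlj => (((mem_polygon_iff _).1 hmax.1).2.2 l).lt_of_ne
        (hgen.realFactor_interPt_ne_zero hij hli hlj).symm)
      (hvert _ (interPt_mem_extremePoints (hgen.pair i j hij) hmax.1) hv1.ne' hv2.ne')
      (slope_mul_slope_neg_of_maxAttainedAt hgen hij hp hq (hslope i j hij).1
        (hslope i j hij).2 hmax)
    simpa only [if_neg hc] using has
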